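/- Let $X$ be a (real) Banach space with a $C^1$ Lipschitz bump function, i.e. a $C^1$ smooth Lipschitz function $b:X\to\mathbb R$ with bounded non-empty support. Let $M$ be a connected, paracompact, Hausdorff $C^1$ Banach manifold modeled on $X$, and let $\|\cdot\|_M:TM\to[0,\infty)$ be a continuous function making $M$ a $C^1$ Finsler manifold in the sense of Palais, that is: (P1) for every $x\in M$ the restriction $\|\cdot\|_x$ of $\|\cdot\|_M$ to $T_xM$ is a norm such that, for every chart $\varphi:U\to X$ with $x\in U$, the norm $v\mapsto\|d\varphi^{-1}(\varphi(x))(v)\|_x$ is equivalent to the norm of $X$; (P2) for every $x_0\in M$, $\varepsilon>0$ and every chart $\varphi:U\to X$ with $x_0\in U$ there is an open neighbourhood $W\subset U$ of $x_0$ such that for all $x\in W$ and $v\in X$, $$\tfrac1{1+\varepsilon}\|d\varphi^{-1}(\varphi(x_0))(v)\|_{x_0}\le\|d\varphi^{-1}(\varphi(x))(v)\|_{x}\le(1+\varepsilon)\|d\varphi^{-1}(\varphi(x_0))(v)\|_{x_0}.$$ Let $d(p,q)=\inf\{\int_a^b\|c'(t)\|_{c(t)}\,dt\}$, the infimum being over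 all piecewise $C^1$ paths $c:[a,b]\to M$ from $p$ to $q$, and assume that $M$ is complete for $d$. For $\Delta\in T_xM^*$ put $\|\Delta\|_x=\sup\{|\Delta(\xi)|:\xi\in T_xM,\ \|\xi\|_x=1\}$. For $f:M\to\mathbb R$ and $x\in M$ let $D^-f(x)$ (respectively $D^+f(x)$) be the set of all $dg(x)\in T_xM^*$ with $g:M\to\mathbb R$ of class $C^1$ such that $f-g$ attains a local minimum (respectively a local maximum) at $x$. For a continuous $H:M\times\mathbb R\to\mathbb R$ consider the equation $$u(x)+H(x,\|du(x)\|_x)=0.\qquad(\mathrm{E}_H)$$ A function $u:M\to\mathbb R$ is a viscosity subsolution of $(\mathrm E_H)$ if it is upper semicontinuous and $u(x)+H(x,\|\Delta\|_x)\le0$ for all $x\in M$ and $\Delta\in D^+u(x)$; it is a viscosity supersolution if it is lower semicontinuous and $u(x)+H(x,\|\Delta\|_x)\ge0$ for all $x\in M$ and $\Delta\in D^-u(x)$. The function $H$ satisfies condition (A) if there are a constant $C\ge0$ and a continuous $\omega:\mathbb R\times\mathbb R\to\mathbb R$ with $\omega(0,0)=0$ such that for all $x_1,x_2\in M$ and $t_1,t_2\in\mathbb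 R$, $$|H(x_1,t_1)-H(x_2,t_2)|\le\omega(d(x_1,x_2),t_1-t_2)+C\max\{|t_1|,|t_2|\}\,d(x_1,x_2).$$ Let $H_1,H_2:M\times\mathbb R\to\mathbb R$ be continuous functions satisfying condition (A). Let $u$ be a bounded viscosity subsolution of $(\mathrm E_{H_1})$ and $v$ a bounded viscosity supersolution of $(\mathrm E_{H_2})$, and assume that for every $x\in M$ either $u$ or $v$ is Lipschitz (with respect to $d$) in a neighbourhood of $x$. Then $$\sup_M(u-v)\le\sup_{M\times\mathbb R}(H_2-H_1),$$ where the right-hand side may be $+\infty$. -/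

import Mathlib

open scoped Manifold Topology

namespace BanachFinsler

noncomputable section

/-- `X` admits a `C¹` Lipschitz bump function: a `C¹`, Lipschitz function `X → ℝ` whose support
(the closure of the set where it does not vanish) is bounded and non-empty. -/
def HasC1LipschitzBump (X : Type*) [NormedAddCommGroup X] [NormedSpace ℝ X] : Prop :=
  ∃ b : X → ℝ, ContDiff ℝ 1 b ∧ (∃ K, LipschitzWith K b) ∧
    Bornology.IsBounded (tsupport b) ∧ (tsupport b).Nonempty

section

variable (X : Type*) [NormedAddCommGroup X] [NormedSpace ℝ X]
  (M : Type*) [TopologicalSpace M] [ChartedSpace X M]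

/-- A `C¹` Finsler structure in the sense of Palais on the `C¹` Banach manifold `M` modelled
on `X`: a continuous function on the tangent bundle, restricting to a norm on each tangent space,
subject to the two conditions of Palais. A chart is any member of the maximal `C¹` atlas; for a
chart `φ` and a vector `v` of `X`, the number `‖dφ⁻¹(φ(x)) v‖_x` is written through
the tangent vector `tangentMap φ.symm (φ x, v)`, whose base point is
`φ.symm (φ x) = x` for `x` in the domain of `φ`. -/
structure FinslerStructure [IsManifold 𝓘(ℝ, X) 1 M] where
  /-- The norm of a tangent vector. -/
  norm : TangentBundle 𝓘(ℝ, X) M → ℝ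
  continuous_norm : Continuous norm
  norm_nonneg : ∀ p, 0 ≤ norm p
  norm_add_le : ∀ (x : M) (v w : TangentSpace 𝓘(ℝ, X) x),
    norm ⟨x, v + w⟩ ≤ norm ⟨x, v⟩ + norm ⟨x, w⟩
  norm_smul : ∀ (x : M) (c : ℝ) (v : TangentSpace 𝓘(ℝ, X) x),
    norm ⟨x, c • v⟩ = |c| * norm ⟨x, v⟩
  eq_zero_of_norm_eq_zero : ∀ (x : M) (v : TangentSpace 𝓘(ℝ, X) x), norm ⟨x, v⟩ = 0 → v = 0
  /-- In every chart around `x`, the norm at `x` is equivalent to the norm of the model space. -/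
  equivalent_norm : ∀ φ ∈ IsManifold.maximalAtlas 𝓘(ℝ, X) 1 M, ∀ x ∈ φ.source,
    ∃ K : ℝ, 1 ≤ K ∧ ∀ v : X,
      K⁻¹ * ‖v‖ ≤ norm (tangentMap 𝓘(ℝ, X) 𝓘(ℝ, X) φ.symm ⟨φ x, v⟩) ∧
      norm (tangentMap 𝓘(ℝ, X) 𝓘(ℝ, X) φ.symm ⟨φ x, v⟩) ≤ K * ‖v‖
  /-- In every chart around `x₀`, the norms at the points `x` close to `x₀` are
  `(1 + ε)`-equivalent to the norm at `x₀`. -/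
  palais : ∀ φ ∈ IsManifold.maximalAtlas 𝓘(ℝ, X) 1 M, ∀ x₀ ∈ φ.source, ∀ ε : ℝ, 0 < ε →
    ∃ W : Set M, IsOpen W ∧ x₀ ∈ W ∧ W ⊆ φ.source ∧ ∀ x ∈ W, ∀ v : X,
      (1 + ε)⁻¹ * norm (tangentMap 𝓘(ℝ, X) 𝓘(ℝ, X) φ.symm ⟨φ x₀, v⟩) ≤
          norm (tangentMap 𝓘(ℝ, X) 𝓘(ℝ, X) φ.symm ⟨φ x, v⟩) ∧
      norm (tangentMap 𝓘(ℝ, X) 𝓘(ℝ, X) φ.symm ⟨φ x, v⟩) ≤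
          (1 + ε) * norm (tangentMap 𝓘(ℝ, X) 𝓘(ℝ, X) φ.symm ⟨φ x₀, v⟩)

/-- `γ` restricted to `[a, b]` is a continuous, piecewise `C¹` path: there is a finite subdivision
`a = s 0 ≤ s 1 ≤ ⋯ ≤ s n = b` such that `γ` is `C¹` on each closed interval `[s i, s (i + 1)]`. -/
def IsPiecewiseC1 {M : Type*} [TopologicalSpace M] [ChartedSpace X M]
    (γ : ℝ → M) (a b : ℝ) : Prop :=
  a ≤ b ∧ ContinuousOn γ (Set.Icc a b) ∧
    ∃ (n : ℕ) (s : ℕ → ℝ), Monotone s ∧ s 0 = a ∧ s n = b ∧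
      ∀ i < n, ContMDiffOn 𝓘(ℝ, ℝ) 𝓘(ℝ, X) 1 γ (Set.Icc (s i) (s (i + 1)))

end

namespace FinslerStructure

variable {X : Type*} [NormedAddCommGroup X] [NormedSpace ℝ X]
  {M : Type*} [TopologicalSpace M] [ChartedSpace X M] [IsManifold 𝓘(ℝ, X) 1 M]

/-- The length `∫ₐᵇ ‖γ'(t)‖_{γ(t)} dt`. (At the finitely many break points of a piecewise `C¹`
path the value of the integrand is irrelevant.) -/
def length (F : FinslerStructure X M) (γ : ℝ → M) (a b : ℝ) : ℝ :=
  ∫ t in a..b, F.norm (tangentMap 𝓘(ℝ, ℝ) 𝓘(ℝ, X) γ ⟨t, (1 : ℝ)⟩)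

/-- The Finsler metric: the infimum of the lengths of the piecewise `C¹` paths from `p` to `q`. -/
def dist (F : FinslerStructure X M) (p q : M) : ℝ :=
  sInf {l : ℝ | ∃ (γ : ℝ → M) (a b : ℝ),
    IsPiecewiseC1 X γ a b ∧ γ a = p ∧ γ b = q ∧ l = F.length γ a b}

/-- Completeness for the Finsler metric: every Cauchy sequence converges. -/
def IsComplete (F : FinslerStructure X M) : Prop :=
  ∀ s : ℕ → M, (∀ ε : ℝ, 0 < ε → ∃ N, ∀ m ≥ N, ∀ n ≥ N, F.dist (s m) (s n) < ε) →
    ∃ x, ∀ ε : ℝ, 0 < ε → ∃ N, ∀ n ≥ N, F.dist (s n) x < ε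

/-- The dual norm of a cotangent vector at `x`: `sup {|Δ ξ| : ‖ξ‖_x = 1}`. -/
def dualNorm (F : FinslerStructure X M) (x : M) (Δ : TangentSpace 𝓘(ℝ, X) x →L[ℝ] ℝ) : ℝ :=
  sSup {r : ℝ | ∃ ξ : TangentSpace 𝓘(ℝ, X) x, F.norm ⟨x, ξ⟩ = 1 ∧ r = |Δ ξ|}

/-- `u` is Lipschitz, for the Finsler metric, in a neighbourhood of `x`. -/
def LipschitzNear (F : FinslerStructure X M) (u : M → ℝ) (x : M) : Prop :=
  ∃ U ∈ 𝓝 x, ∃ L : ℝ, 0 ≤ L ∧ ∀ y ∈ U, ∀ z ∈ U, |u y - u z| ≤ L * F.dist y z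

end FinslerStructure

section

variable {M : Type*} [TopologicalSpace M]
  (X : Type*) [NormedAddCommGroup X] [NormedSpace ℝ X] [ChartedSpace X M]

/-- The set `D⁻f(x)` of subdifferentials: the differentials `dg(x)` of the `C¹` functions
`g : M → ℝ` such that `f - g` has a local minimum at `x`. -/
def subdifferential (f : M → ℝ) (x : M) : Set (TangentSpace 𝓘(ℝ, X) x →L[ℝ] ℝ) :=
  {Δ | ∃ g : M → ℝ, ContMDiff 𝓘(ℝ, X) 𝓘(ℝ, ℝ) 1 g ∧ IsLocalMin (fun y => f y - g y) x ∧
    mfderiv 𝓘(ℝ, X) 𝓘(ℝ, ℝ) g x = Δ}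

/-- The set `D⁺f(x)` of superdifferentials: the differentials `dg(x)` of the `C¹` functions
`g : M → ℝ` such that `f - g` has a local maximum at `x`. -/
def superdifferential (f : M → ℝ) (x : M) : Set (TangentSpace 𝓘(ℝ, X) x →L[ℝ] ℝ) :=
  {Δ | ∃ g : M → ℝ, ContMDiff 𝓘(ℝ, X) 𝓘(ℝ, ℝ) 1 g ∧ IsLocalMax (fun y => f y - g y) x ∧
    mfderiv 𝓘(ℝ, X) 𝓘(ℝ, ℝ) g x = Δ}

end

section

variable {X : Type*} [NormedAddCommGroup X] [NormedSpace ℝ X]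
  {M : Type*} [TopologicalSpace M] [ChartedSpace X M] [IsManifold 𝓘(ℝ, X) 1 M]

/-- Viscosity subsolutions of `u(x) + H(x, ‖du(x)‖_x) = 0`. -/
def IsViscositySubsolution (F : FinslerStructure X M) (H : M × ℝ → ℝ) (u : M → ℝ) : Prop :=
  UpperSemicontinuous u ∧
    ∀ x, ∀ Δ ∈ superdifferential X u x, u x + H (x, F.dualNorm x Δ) ≤ 0

/-- Viscosity supersolutions of `u(x) + H(x, ‖du(x)‖_x) = 0`. -/
def IsViscositySupersolution (F : FinslerStructure X M) (H : M × ℝ → ℝ) (u : M → ℝ) : Prop :=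
  LowerSemicontinuous u ∧
    ∀ x, ∀ Δ ∈ subdifferential X u x, 0 ≤ u x + H (x, F.dualNorm x Δ)

/-- Condition (A): a modulus of continuity for the Hamiltonian `H`. -/
def ConditionA (F : FinslerStructure X M) (H : M × ℝ → ℝ) : Prop :=
  ∃ C : ℝ, 0 ≤ C ∧ ∃ ω : ℝ × ℝ → ℝ, Continuous ω ∧ ω (0, 0) = 0 ∧
    ∀ (x₁ x₂ : M) (t₁ t₂ : ℝ),
      |H (x₁, t₁) - H (x₂, t₂)| ≤
        ω (F.dist x₁ x₂, t₁ - t₂) + C * max |t₁| |t₂| * F.dist x₁ x₂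

end

end

end BanachFinsler

namespace BanachFinsler
noncomputable section

open Filter Set

/-! ### A variational principle with gauges -/

/-! If `v - u` attained its minimum at `x₀` and both functions were differentiable there, the two
differentials would agree and subtracting the equations would finish the proof. The argument is an
approximate version of this.

Ekeland's principle for the complete metric `F.dist` (`exists_ekeland`) gives a point `x₀` that
almost minimises `v - u` and minimises `v - u + ε d(·, x₀)`. The distance need not be smooth. In a
chart around `x₀` where the Finsler norm is nearly constant (`IsGoodBall`), it is dominated by `2
N(· - y₀)`, where `N` is the frozen norm at `x₀`. Hence a sum of three functions on `X` has a local
minimum at `y₀`: a semicontinuous one, a Lipschitz one (whichever of `-u`, `v` is Lipschitz near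
`x₀`), and `2 ε N(· - y₀)`.

The fuzzy sum rule `exists_fuzzy_sum` yields `C¹` test functions at three nearby points whose
derivatives almost cancel. It rests on a smooth variational principle built from the bump function.
The derivative for `2 ε N` is of size `ε`, so the other two are almost opposite; the Lipschitz one
is bounded, hence so is the other. Cutting the test functions off carries them to `M`
(`exists_mem_subdifferential`), and the Palais condition compares dual norms at the two points.

The outcome (`exists_subdifferential_pair`, `exists_comparison`) is a pair of points with momenta
`t₁, t₂` that are almost equal and whose product with the distance is small. This is what condition
(A) needs to replace `H₁ (x₁, t₁)` by `H₁ (x₂, t₂)`. -/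

theorem exists_near_min {Z : Type*} (g : Z → ℝ) {m : ℝ} (hm : ∀ z, m ≤ g z) (y : Z) {δ : ℝ}
    (hδ : 0 < δ) : ∃ x, g x ≤ g y ∧ ∀ z, g x < g z + δ := by
  have : Nonempty Z := ⟨y⟩
  have hb : BddBelow (range g) := ⟨m, by rintro _ ⟨z, rfl⟩; exact hm z⟩
  -- If `y` is already `δ`-minimal it is kept; otherwise every `δ`-minimal point lies below `y`.
  by_cases h : g y < (⨅ z, g z) + δ
  · exact ⟨y, le_rfl, fun z => h.trans_le (by gcongr; exact ciInf_le hb z)⟩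
  · obtain ⟨x, hx⟩ := exists_lt_of_ciInf_lt (show (⨅ z, g z) < (⨅ z, g z) + δ by linarith)
    exact ⟨x, (hx.trans_le (not_lt.1 h)).le,
      fun z => hx.trans_le (by gcongr; exact ciInf_le hb z)⟩

/-- A lower semicontinuous function bounded below attains its minimum after the addition of a
series of small multiples of gauges. -/
theorem exists_min_add_tsum_gauge {Z : Type*} [TopologicalSpace Z] [Nonempty Z]
    {Φ : Z → ℝ} (hΦ : LowerSemicontinuous Φ) {m : ℝ} (hm : ∀ z, m ≤ Φ z)
    {ρ : ℕ → Z → Z → ℝ} (hρ : ∀ i x y, 0 ≤ ρ i x y) (hself : ∀ i x, ρ i x x = 0)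
    (hlsc : ∀ i y, LowerSemicontinuous fun x => ρ i x y)
    (hcompl : ∀ s : ℕ → Z, (∀ i j, i < j → ρ i (s j) (s i) < 1) → ∃ x, Tendsto s atTop (𝓝 x))
    {δ : ℕ → ℝ} (hδ : ∀ i, 0 < δ i) (hsum : Summable δ) :
    ∃ (c : ℕ → Z) (x : Z), (∀ i, ρ i x (c i) < 1) ∧ (∀ z, Φ x ≤ Φ z + δ 0) ∧
      ∀ z, Summable (fun i => δ i * ρ i z (c i)) →
        Φ x + ∑' i, δ i * ρ i x (c i) ≤ Φ z + ∑' i, δ i * ρ i z (c i) := by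
  classical
  obtain ⟨z₀⟩ := ‹Nonempty Z›
  have : Nonempty Z := ⟨z₀⟩
  -- A total choice function lets the sequence be defined by plain recursion, with its properties
  -- proved afterwards.
  let pick : (Z → ℝ) → Z → ℝ → Z := fun g y d =>
    Classical.epsilon fun x => g x ≤ g y ∧ ∀ z, g x < g z + d
  have pick_spec : ∀ g : Z → ℝ, (∀ z, m ≤ g z) → ∀ y d, 0 < d →
      g (pick g y d) ≤ g y ∧ ∀ z, g (pick g y d) < g z + d := fun g hg y d hd =>
    Classical.epsilon_spec (exists_near_min g hg y hd)
  let next : ℕ → (Z → ℝ) × Z → (Z → ℝ) × Z := fun n p =>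
    (fun z => p.1 z + δ n * ρ n z p.2,
      pick (fun z => p.1 z + δ n * ρ n z p.2) p.2 (δ (n + 1)))
  let σ : ℕ → (Z → ℝ) × Z := fun n => Nat.rec (Φ, pick Φ z₀ (δ 0)) next n
  let c : ℕ → Z := fun n => (σ n).2
  let f : ℕ → Z → ℝ := fun n => (σ n).1
  have f_succ : ∀ n z, f (n + 1) z = f n z + δ n * ρ n z (c n) := fun n z => rfl
  have f_eq : ∀ n z, f n z = Φ z + ∑ i ∈ Finset.range n, δ i * ρ i z (c i) := by
    intro n z
    induction n with
    | zero => simp [f, σ]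
    | succ n ih => rw [f_succ, ih, Finset.sum_range_succ]; ring
  have nn : ∀ i z, 0 ≤ δ i * ρ i z (c i) := fun i z => mul_nonneg (hδ i).le (hρ _ _ _)
  have Φ_le : ∀ n z, Φ z ≤ f n z := fun n z => by
    rw [f_eq]; linarith [Finset.sum_nonneg fun i (_ : i ∈ Finset.range n) => nn i z]
  have c_near : ∀ n z, f n (c n) < f n z + δ n := by
    intro n
    cases n with
    | zero => exact (pick_spec Φ hm z₀ _ (hδ 0)).2
    | succ n => exact (pick_spec (f (n + 1)) (fun z => (hm z).trans (Φ_le (n + 1) z)) (c n) _ (hδ _)).2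
  have c_desc : ∀ n, f (n + 1) (c (n + 1)) ≤ f (n + 1) (c n) := fun n =>
    (pick_spec (f (n + 1)) (fun z => (hm z).trans (Φ_le (n + 1) z)) (c n) _ (hδ _)).1
  have f_lsc : ∀ n, LowerSemicontinuous (f n) := by
    intro n
    induction n with
    | zero => exact hΦ
    | succ n ih =>
      refine ih.add (g := fun z => δ n * ρ n z (c n)) ?_
      exact (continuous_const_mul (δ n)).comp_lowerSemicontinuous (hlsc n (c n))
        (monotone_mul_left_of_nonneg (hδ n).le)
  -- These closed sets are nested because each centre does not increase the next function. Since `c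
  -- n` is `δ n`-minimal for `f n`, on `S n` the gauge centred at `c n` is below `1`; thus `hcompl`
  -- applies and the limit lies in every `S n`.
  let S : ℕ → Set Z := fun n => {z | f (n + 1) z ≤ f n (c n)}
  have f_self : ∀ n, f (n + 1) (c n) = f n (c n) := fun n => by simp [f_succ, hself]
  have S_closed : ∀ n, IsClosed (S n) := fun n => (f_lsc (n + 1)).isClosed_preimage _
  have S_anti : Antitone S := antitone_nat_of_succ_le fun n z hz => by
    have h1 : f (n + 2) z ≤ f (n + 1) (c (n + 1)) := hz
    have h2 := f_succ (n + 1) z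
    have h3 := nn (n + 1) z
    have h4 := c_desc n
    rw [f_self] at h4
    change f (n + 1) z ≤ f n (c n)
    linarith
  have c_mem : ∀ n, c n ∈ S n := fun n => (f_self n).le
  have S_small : ∀ n, ∀ z ∈ S n, ρ n z (c n) < 1 := fun n z hz => by
    have h1 : f n z + δ n * ρ n z (c n) ≤ f n (c n) := hz
    have h2 := c_near n z
    have h3 : δ n * ρ n z (c n) < δ n * 1 := by linarith
    exact lt_of_mul_lt_mul_left h3 (hδ n).le
  obtain ⟨x, hx⟩ := hcompl c fun i j hij => S_small i _ (S_anti hij.le (c_mem j))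
  have x_mem : ∀ n, x ∈ S n := fun n => (S_closed n).mem_of_tendsto hx
    (eventually_atTop.2 ⟨n, fun k hk => S_anti hk (c_mem k)⟩)
  refine ⟨c, x, fun i => S_small i x (x_mem i), fun z => ?_, fun z hz => ?_⟩
  · have h1 : f 1 x ≤ f 0 (c 0) := x_mem 0
    exact (Φ_le 1 x).trans (h1.trans (c_near 0 z).le)
  · have hxs : Summable fun i => δ i * ρ i x (c i) :=
      Summable.of_nonneg_of_le (fun i => nn i x)
        (fun i => mul_le_of_le_one_right (hδ i).le (S_small i x (x_mem i)).le) hsum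
    have T1 : Tendsto (fun n => f (n + 1) x) atTop (𝓝 (Φ x + ∑' i, δ i * ρ i x (c i))) := by
      have := (hxs.hasSum.tendsto_sum_nat.const_add (Φ x)).comp (tendsto_add_atTop_nat 1)
      exact this.congr fun n => (f_eq _ _).symm
    have T2 : Tendsto (fun n => f n z + δ n) atTop
        (𝓝 (Φ z + ∑' i, δ i * ρ i z (c i) + 0)) := by
      refine Tendsto.add ?_ hsum.tendsto_atTop_zero
      exact (hz.hasSum.tendsto_sum_nat.const_add (Φ z)).congr fun n => (f_eq _ _).symm
    rw [add_zero] at T2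
    -- Membership in `S n` and `δ n`-minimality of `c n` are chained, and `n` tends to infinity.
    refine le_of_tendsto_of_tendsto' T1 T2 fun n => ?_
    have h1 : f (n + 1) x ≤ f n (c n) := x_mem n
    exact h1.trans (c_near n z).le

/-! ### Bump functions -/

/-- A `C¹` Lipschitz bump function equal to `1` near the origin, supported in the unit ball. -/
structure UnitBump (X : Type*) [NormedAddCommGroup X] [NormedSpace ℝ X] where
  toFun : X → ℝ
  lip : NNReal
  contDiff : ContDiff ℝ 1 toFun
  lipschitz : LipschitzWith lip toFun
  nonneg : ∀ x, 0 ≤ toFun x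
  le_one : ∀ x, toFun x ≤ 1
  eventually_one : ∀ᶠ x in 𝓝 0, toFun x = 1
  eq_zero : ∀ x, 1 ≤ ‖x‖ → toFun x = 0

theorem HasC1LipschitzBump.nonempty_unitBump {X : Type*} [NormedAddCommGroup X] [NormedSpace ℝ X]
    (h : HasC1LipschitzBump X) : Nonempty (UnitBump X) := by
  obtain ⟨b, hb, ⟨K, hK⟩, hbd, hne⟩ := h
  obtain ⟨x₀, hx₀⟩ : ∃ x₀, b x₀ ≠ 0 := by
    by_contra! H
    have : b = 0 := funext H
    simp [this] at hne
  obtain ⟨R, hR⟩ := hbd.subset_closedBall 0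
  -- Large enough that `‖x‖ ≥ 1` forces `x₀ + T • x` out of the ball of radius `R`.
  set T : ℝ := max R 0 + ‖x₀‖ + 1 with hT
  have hT1 : 0 < T := by positivity
  -- Composing with a bump centred at `1` confines values to `[0, 1]`, sends `0` to `0`, and makes
  -- the result identically `1` near the origin, as later cut-offs require.
  let ψ : ContDiffBump (1 : ℝ) := ⟨1 / 4, 1 / 2, by norm_num, by norm_num⟩
  obtain ⟨K', hK'⟩ := (ψ.contDiff (n := 1)).lipschitzWith_of_hasCompactSupport
    ψ.hasCompactSupport one_ne_zero
  let h : X → ℝ := fun x => (b x₀)⁻¹ * b (x₀ + T • x)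
  have h_diff : ContDiff ℝ 1 h := by fun_prop
  have h0 : h 0 = 1 := by simp [h, hx₀]
  have h_lip : ∃ K'', LipschitzWith K'' h := by
    refine ⟨‖(b x₀)⁻¹‖₊ * (K * ‖T‖₊), LipschitzWith.of_dist_le_mul fun x y => ?_⟩
    have h1 := hK.dist_le_mul (x₀ + T • x) (x₀ + T • y)
    rw [dist_add_left, dist_smul₀] at h1
    simp only [h, Real.dist_eq, ← mul_sub, abs_mul] at h1 ⊢
    push_cast
    rw [mul_assoc, mul_assoc, Real.norm_eq_abs]
    gcongr
  obtain ⟨K'', hK''⟩ := h_lip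
  refine ⟨⟨ψ ∘ h, K' * K'', ψ.contDiff.comp h_diff, hK'.comp hK'', fun x => ψ.nonneg,
    fun x => ψ.le_one, ?_, fun x hx => ?_⟩⟩
  · have : Tendsto h (𝓝 0) (𝓝 1) := h0 ▸ h_diff.continuous.tendsto 0
    exact this.eventually ψ.eventuallyEq_one
  · have hz : b (x₀ + T • x) = 0 := by
      by_contra hne
      have := hR (subset_tsupport _ hne)
      rw [mem_closedBall_zero_iff] at this
      have h2 : ‖T • x‖ ≤ ‖x₀ + T • x‖ + ‖x₀‖ := by
        simpa using norm_sub_le (x₀ + T • x) x₀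
      rw [norm_smul, Real.norm_of_nonneg hT1.le] at h2
      have : T ≤ T * ‖x‖ := le_mul_of_one_le_right hT1.le hx
      linarith [le_max_left R 0]
    have : h x = 0 := by simp [h, hz]
    simp only [Function.comp, this]
    exact ψ.zero_of_le_dist (by norm_num [Real.dist_eq, ψ])

end
end BanachFinsler

/-! ### Smooth gauges and their series -/

namespace BanachFinsler
noncomputable section

open Filter Set

namespace UnitBump

variable {X : Type*} [NormedAddCommGroup X] [NormedSpace ℝ X] (b : UnitBump X)

/-- The function `1 - b (x / r)`, which vanishes at `0` and equals `1` outside the ball of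
radius `r`. -/
def gauge (r : ℝ) (x : X) : ℝ := 1 - b.toFun (r⁻¹ • x)

theorem gauge_contDiff (r : ℝ) : ContDiff ℝ 1 (b.gauge r) := by
  have := b.contDiff
  unfold gauge
  fun_prop

theorem gauge_nonneg (r : ℝ) (x : X) : 0 ≤ b.gauge r x := sub_nonneg.2 (b.le_one _)

theorem gauge_le_one (r : ℝ) (x : X) : b.gauge r x ≤ 1 := sub_le_self _ (b.nonneg _)

theorem gauge_zero (r : ℝ) : b.gauge r 0 = 0 := by
  simp [gauge, b.eventually_one.self_of_nhds]

theorem gauge_eq_one {r : ℝ} (hr : 0 < r) {x : X} (hx : r ≤ ‖x‖) : b.gauge r x = 1 := by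
  have : 1 ≤ ‖r⁻¹ • x‖ := by
    rw [norm_smul, norm_inv, Real.norm_of_nonneg hr.le, inv_mul_eq_div]
    exact (one_le_div hr).2 hx
  simp [gauge, b.eq_zero _ this]

theorem gauge_lipschitz {r : ℝ} (hr : 0 < r) :
    LipschitzWith (b.lip * r⁻¹.toNNReal) (b.gauge r) := by
  refine LipschitzWith.of_dist_le_mul fun x y => ?_
  have h := b.lipschitz.dist_le_mul (r⁻¹ • x) (r⁻¹ • y)
  rw [dist_smul₀, Real.norm_of_nonneg (inv_pos.2 hr).le] at h
  simp only [gauge, dist_sub_left]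
  push_cast
  rw [Real.coe_toNNReal _ (inv_pos.2 hr).le, mul_assoc]
  exact h

theorem norm_fderiv_gauge_le {r : ℝ} (hr : 0 < r) (x : X) :
    ‖fderiv ℝ (b.gauge r) x‖ ≤ b.lip * r⁻¹ := by
  have := norm_fderiv_le_of_lipschitz ℝ (b.gauge_lipschitz hr) (x₀ := x)
  rwa [NNReal.coe_mul, Real.coe_toNNReal _ (inv_pos.2 hr).le] at this

variable {δ r : ℕ → ℝ} (c : ℕ → X)

theorem summable_gauge (hδ : ∀ i, 0 ≤ δ i) (hs : Summable δ) (x : ℕ → X) :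
    Summable fun i => δ i * b.gauge (r i) (x i) :=
  Summable.of_nonneg_of_le (fun i => mul_nonneg (hδ i) (b.gauge_nonneg _ _))
    (fun i => mul_le_of_le_one_right (hδ i) (b.gauge_le_one _ _)) hs

theorem norm_fderiv_term_le (hδ : ∀ i, 0 ≤ δ i) (hr : ∀ i, 0 < r i) (i : ℕ) (x : X) :
    ‖fderiv ℝ (fun x => δ i * b.gauge (r i) (x - c i)) x‖ ≤ b.lip * (δ i * (r i)⁻¹) := by
  have hd : DifferentiableAt ℝ (fun x => b.gauge (r i) (x - c i)) x :=
    (((b.gauge_contDiff (r i)).differentiable one_ne_zero).comp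
      (differentiable_id.sub_const (c i))).differentiableAt
  rw [fderiv_const_mul hd, norm_smul, Real.norm_of_nonneg (hδ i), fderiv_comp_sub]
  have := b.norm_fderiv_gauge_le (hr i) (x - c i)
  nlinarith [mul_le_mul_of_nonneg_left this (hδ i)]

/-- The terms are bounded by `δ i` and their derivatives by a multiple of `δ i / r i`; both
majorants are summable, so the series may be differentiated termwise. -/
theorem contDiff_tsum_gauge (hδ : ∀ i, 0 ≤ δ i) (hr : ∀ i, 0 < r i) (hs : Summable δ)
    (hs' : Summable fun i => δ i * (r i)⁻¹) :
    ContDiff ℝ 1 fun x => ∑' i, δ i * b.gauge (r i) (x - c i) := by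
  refine contDiff_tsum (v := fun k i => if k = 0 then δ i else b.lip * (δ i * (r i)⁻¹))
    (fun i => ?_) (fun k hk => ?_) (fun k i x hk => ?_)
  · have := b.gauge_contDiff (r i)
    fun_prop
  · by_cases h : k = 0
    · simpa [h] using hs
    · simpa [h] using hs'.mul_left _
  · by_cases h : k = 0
    · subst h
      simp only [norm_iteratedFDeriv_zero, if_true]
      rw [Real.norm_of_nonneg (mul_nonneg (hδ i) (b.gauge_nonneg _ _))]
      exact mul_le_of_le_one_right (hδ i) (b.gauge_le_one _ _)
    · have hk1 : k = 1 := by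
        have : k ≤ 1 := by exact_mod_cast hk
        omega
      subst hk1
      rw [norm_iteratedFDeriv_one]
      simpa using b.norm_fderiv_term_le c hδ hr i x

theorem norm_fderiv_tsum_gauge_le (hδ : ∀ i, 0 ≤ δ i) (hr : ∀ i, 0 < r i) (hs : Summable δ)
    (hs' : Summable fun i => δ i * (r i)⁻¹) (x : X) :
    ‖fderiv ℝ (fun x => ∑' i, δ i * b.gauge (r i) (x - c i)) x‖ ≤
      b.lip * ∑' i, δ i * (r i)⁻¹ := by
  have hsum : Summable fun i => b.lip * (δ i * (r i)⁻¹) := hs'.mul_left _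
  rw [fderiv_tsum_apply hsum (fun i => ?_) (b.norm_fderiv_term_le c hδ hr)
    (b.summable_gauge hδ hs fun i => x - c i)]
  · rw [← tsum_mul_left]
    exact tsum_of_norm_bounded hsum.hasSum fun i => b.norm_fderiv_term_le c hδ hr i x
  · have := (b.gauge_contDiff (r i)).differentiable one_ne_zero
    fun_prop

end UnitBump

end
end BanachFinsler

/-! ### Smooth variational principle and fuzzy sum rule on the Banach space -/

namespace BanachFinsler
noncomputable section

open Filter Set

variable {X : Type*} [NormedAddCommGroup X] [NormedSpace ℝ X] [CompleteSpace X]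

/-- A smooth variational principle in three variables, with separated perturbations. -/
theorem UnitBump.exists_min_add_separated (b : UnitBump X) {B : Set X} (hB : IsClosed B)
    (hne : B.Nonempty) {Φ : B × B × B → ℝ} (hΦ : LowerSemicontinuous Φ) {m : ℝ}
    (hm : ∀ p, m ≤ Φ p) {κ : ℝ} (hκ : 0 < κ) :
    ∃ G₁ G₂ G₃ : X → ℝ, (∀ G, G = G₁ ∨ G = G₂ ∨ G = G₃ → ContDiff ℝ 1 G ∧
        (∀ x, 0 ≤ G x ∧ G x ≤ 2 * κ ∧ ‖fderiv ℝ G x‖ ≤ b.lip * (2 * κ))) ∧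
      ∃ p : B × B × B, ∀ q : B × B × B,
        Φ p + (G₁ p.1 + G₂ p.2.1 + G₃ p.2.2) ≤ Φ q + (G₁ q.1 + G₂ q.2.1 + G₃ q.2.2) := by
  have : Nonempty B := hne.to_subtype
  have : CompleteSpace B := hB.completeSpace_coe
  -- Shrinking radii force Cauchy sequences, while the weights decay faster than the radii so that
  -- the derivative bounds `δ i / r i` sum to `2 * κ`.
  let r : ℕ → ℝ := fun i => (1 / 2) ^ i
  let δ : ℕ → ℝ := fun i => κ * (1 / 4) ^ i
  have hr : ∀ i, 0 < r i := fun i => by positivity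
  have hδ : ∀ i, 0 < δ i := fun i => by positivity
  have hδ' : ∀ i, 0 ≤ δ i := fun i => (hδ i).le
  have hs : HasSum δ (κ * (1 - 1 / 4)⁻¹) :=
    (hasSum_geometric_of_lt_one (by norm_num) (by norm_num)).mul_left κ
  have hs' : HasSum (fun i => δ i * (r i)⁻¹) (κ * (1 - 1 / 2)⁻¹) := by
    have h : (fun i => δ i * (r i)⁻¹) = fun i => κ * (1 / 2) ^ i := funext fun i => by
      simp only [δ, r]
      rw [mul_assoc, ← inv_pow, ← mul_pow]
      norm_num
    rw [h]
    exact (hasSum_geometric_of_lt_one (by norm_num) (by norm_num)).mul_left κ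
  -- A sum over the coordinates, so that the total perturbation splits into functions of one
  -- variable each.
  let ρ : ℕ → B × B × B → B × B × B → ℝ := fun i p q =>
    b.gauge (r i) (p.1 - q.1) + b.gauge (r i) (p.2.1 - q.2.1) + b.gauge (r i) (p.2.2 - q.2.2)
  have hρc : ∀ i q, Continuous fun p => ρ i p q := fun i q => by
    have := (b.gauge_contDiff (r i)).continuous
    fun_prop
  have hsmall : ∀ i p q, ρ i p q < 1 → dist p q < r i := fun i p q h => by
    have h1 := b.gauge_nonneg (r i) (p.1 - q.1)
    have h2 := b.gauge_nonneg (r i) (p.2.1 - q.2.1)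
    have h3 := b.gauge_nonneg (r i) (p.2.2 - q.2.2)
    have key : ∀ x y : B, b.gauge (r i) (x - y) < 1 → dist x y < r i := fun x y hxy => by
      by_contra hcon
      rw [Subtype.dist_eq, dist_eq_norm] at hcon
      exact hxy.ne (b.gauge_eq_one (hr i) (not_lt.1 hcon))
    simp only [Prod.dist_eq, max_lt_iff]
    simp only [ρ] at h
    exact ⟨key _ _ (by linarith), key _ _ (by linarith), key _ _ (by linarith)⟩
  obtain ⟨c, p, -, -, hp⟩ := exists_min_add_tsum_gauge hΦ hm (ρ := ρ)
    (fun i x y => add_nonneg (add_nonneg (b.gauge_nonneg _ _) (b.gauge_nonneg _ _))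
      (b.gauge_nonneg _ _))
    (fun i x => by simp [ρ, b.gauge_zero]) (fun i y => (hρc i y).lowerSemicontinuous)
    (fun s hS => by
      refine cauchySeq_tendsto_of_complete (Metric.cauchySeq_iff'.2 fun ε hε => ?_)
      obtain ⟨N, hN⟩ := exists_pow_lt_of_lt_one hε (show (1 / 2 : ℝ) < 1 by norm_num)
      refine ⟨N, fun n hn => ?_⟩
      rcases hn.eq_or_lt with rfl | h
      · simpa using hε
      · exact (hsmall _ _ _ (hS N n h)).trans hN) hδ hs.summable
  let G : (ℕ → X) → X → ℝ := fun a x => ∑' i, δ i * b.gauge (r i) (x - a i)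
  have hG : ∀ a, ContDiff ℝ 1 (G a) ∧
      (∀ x, 0 ≤ G a x ∧ G a x ≤ 2 * κ ∧ ‖fderiv ℝ (G a) x‖ ≤ b.lip * (2 * κ)) := fun a => by
    refine ⟨b.contDiff_tsum_gauge a hδ' hr hs.summable hs'.summable, fun x => ⟨?_, ?_, ?_⟩⟩
    · exact tsum_nonneg fun i => mul_nonneg (hδ' i) (b.gauge_nonneg _ _)
    · refine ((b.summable_gauge hδ' hs.summable _).tsum_le_tsum
        (fun i => mul_le_of_le_one_right (hδ' i) (b.gauge_le_one _ _)) hs.summable).trans ?_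
      rw [hs.tsum_eq]
      linarith
    · refine (b.norm_fderiv_tsum_gauge_le a hδ' hr hs.summable hs'.summable x).trans ?_
      rw [hs'.tsum_eq]
      norm_num [mul_comm]
  have hsplit : ∀ q : B × B × B, HasSum (fun i => δ i * ρ i q (c i))
      (G (fun i => (c i).1) q.1 + G (fun i => (c i).2.1) q.2.1 +
        G (fun i => (c i).2.2) q.2.2) := fun q => by
    have h := fun x => b.summable_gauge (r := r) hδ' hs.summable x
    simp only [ρ, mul_add]
    exact ((h _).hasSum.add (h _).hasSum).add (h _).hasSum
  refine ⟨G fun i => (c i).1, G fun i => (c i).2.1, G fun i => (c i).2.2, ?_, p, fun q => ?_⟩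
  · rintro _ (rfl | rfl | rfl) <;> exact hG _
  · have := hp q (hsplit q).summable
    rw [(hsplit p).tsum_eq, (hsplit q).tsum_eq] at this
    exact this

/-- A fuzzy sum rule: if the sum of a lower semicontinuous function and two Lipschitz functions
has a local minimum at `y₀`, then there are subdifferentials of the three functions at points
close to `y₀` whose sum is small. -/
theorem UnitBump.exists_fuzzy_sum (b : UnitBump X) {y₀ : X} {R : ℝ} (hR : 0 < R)
    {f₁ f₂ f₃ : X → ℝ} (h₁ : LowerSemicontinuousOn f₁ (Metric.closedBall y₀ R))
    {m : ℝ} (hm : ∀ y ∈ Metric.closedBall y₀ R, m ≤ f₁ y ∧ m ≤ f₂ y ∧ m ≤ f₃ y) {L : ℝ}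
    (hL : 0 ≤ L)
    (h₂ : ∀ y ∈ Metric.closedBall y₀ R, ∀ z ∈ Metric.closedBall y₀ R,
      |f₂ y - f₂ z| ≤ L * ‖y - z‖)
    (h₃ : ∀ y ∈ Metric.closedBall y₀ R, ∀ z ∈ Metric.closedBall y₀ R,
      |f₃ y - f₃ z| ≤ L * ‖y - z‖)
    (hmin : ∀ y ∈ Metric.closedBall y₀ R, f₁ y₀ + f₂ y₀ + f₃ y₀ ≤ f₁ y + f₂ y + f₃ y)
    {ε : ℝ} (hε : 0 < ε) :
    ∃ y z w : X, y ∈ Metric.ball y₀ (min ε R) ∧ z ∈ Metric.ball y₀ (min ε R) ∧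
      w ∈ Metric.ball y₀ (min ε R) ∧
      f₁ y + f₂ z + f₃ w ≤ f₁ y₀ + f₂ y₀ + f₃ y₀ + ε ∧
      ∃ g₁ g₂ g₃ : X → ℝ, ContDiff ℝ 1 g₁ ∧ ContDiff ℝ 1 g₂ ∧ ContDiff ℝ 1 g₃ ∧
        IsLocalMin (fun x => f₁ x - g₁ x) y ∧ IsLocalMin (fun x => f₂ x - g₂ x) z ∧
        IsLocalMin (fun x => f₃ x - g₃ x) w ∧
        ‖fderiv ℝ g₁ y + fderiv ℝ g₂ z + fderiv ℝ g₃ w‖ ≤ ε := by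
  set B := Metric.closedBall y₀ R with hBdef
  have hB : IsClosed B := Metric.isClosed_closedBall
  have hy₀ : y₀ ∈ B := Metric.mem_closedBall_self hR.le
  set s₀ := f₁ y₀ + f₂ y₀ + f₃ y₀ with hs₀
  set ρ : ℝ := min ε R / 2 with hρ
  have hρ0 : 0 < ρ := by positivity
  set l : ℝ := (b.lip : ℝ) with hl
  have hl0 : 0 ≤ l := b.lip.2
  -- `τ` is the weight of the localising gauge; the denominator absorbs the derivatives of that
  -- gauge and of the three perturbations in the final estimate.
  set τ : ℝ := ε / (1 + l * ρ⁻¹ + l) with hτ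
  have hden : 0 < 1 + l * ρ⁻¹ + l := by positivity
  have hτ0 : 0 < τ := by positivity
  have hτe : τ * (1 + l * ρ⁻¹ + l) = ε := div_mul_cancel₀ _ hden.ne'
  have hτε : τ ≤ ε := by
    rw [← hτe]
    refine le_mul_of_one_le_right hτ0.le ?_
    have : 0 ≤ l * ρ⁻¹ := by positivity
    linarith
  set η : ℝ := min ρ (τ / (8 * (L + 1))) with hη
  have hη0 : 0 < η := by positivity
  have hηL : L * η ≤ τ / 8 := by
    have h1 : η ≤ τ / (8 * (L + 1)) := min_le_right _ _
    calc L * η ≤ (L + 1) * (τ / (8 * (L + 1))) := by gcongr; linarith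
      _ = τ / 8 := by field_simp
  set κ : ℝ := τ / 48 with hκ
  have hκ0 : 0 < κ := by positivity
  -- `A` exceeds the possible gain in the sum of the three functions, so at the minimum neither
  -- coupling gauge can equal `1`: the points are within `η` of each other.
  set A : ℝ := s₀ - 3 * m + ε + 1 with hA
  have hs₀m : 3 * m ≤ s₀ := by have := hm y₀ hy₀; linarith
  have hA0 : 0 ≤ A := by linarith
  -- The variables are decoupled and tied together only by functions of `y - z` and `y - w`, whose
  -- derivatives cancel when the three partial derivatives are added.
  let Φ : B × B × B → ℝ := fun p => f₁ p.1 + f₂ p.2.1 + f₃ p.2.2 +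
    (A * b.gauge η (p.1 - p.2.1) + A * b.gauge η (p.1 - p.2.2) + τ * b.gauge ρ (p.1 - y₀))
  have lip_cont : ∀ f : X → ℝ, (∀ y ∈ B, ∀ z ∈ B, |f y - f z| ≤ L * ‖y - z‖) →
      Continuous (fun x : B => f x) := fun f hf => by
    refine LipschitzWith.continuous (K := L.toNNReal) (LipschitzWith.of_dist_le_mul fun x y => ?_)
    rw [Real.coe_toNNReal _ hL, Real.dist_eq, Subtype.dist_eq, dist_eq_norm]
    exact hf x x.2 y y.2
  have gη := (b.gauge_contDiff η).continuous
  have gρ := (b.gauge_contDiff ρ).continuous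
  have hΦ : LowerSemicontinuous Φ := by
    have e0 : LowerSemicontinuous fun x : B => f₁ x := lowerSemicontinuous_restrict_iff.2 h₁
    have e1 : LowerSemicontinuous fun p : B × B × B => f₁ p.1 := e0.comp continuous_fst
    have e2 : Continuous fun p : B × B × B => f₂ p.2.1 :=
      (lip_cont f₂ h₂).comp (continuous_fst.comp continuous_snd)
    have e3 : Continuous fun p : B × B × B => f₃ p.2.2 :=
      (lip_cont f₃ h₃).comp (continuous_snd.comp continuous_snd)
    refine ((e1.add e2.lowerSemicontinuous).add e3.lowerSemicontinuous).add ?_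
    exact Continuous.lowerSemicontinuous (by fun_prop)
  have hpen : ∀ p : B × B × B, 0 ≤ A * b.gauge η (p.1 - p.2.1) ∧
      0 ≤ A * b.gauge η (p.1 - p.2.2) ∧ 0 ≤ τ * b.gauge ρ (p.1 - y₀) := fun p =>
    ⟨mul_nonneg hA0 (b.gauge_nonneg _ _), mul_nonneg hA0 (b.gauge_nonneg _ _),
      mul_nonneg hτ0.le (b.gauge_nonneg _ _)⟩
  have hΦm : ∀ p, 3 * m ≤ Φ p := fun p => by
    have h1 := (hm _ p.1.2).1
    have h2 := (hm _ p.2.1.2).2.1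
    have h3 := (hm _ p.2.2.2).2.2
    have h4 := hpen p
    simp only [Φ]
    linarith
  obtain ⟨G₁, G₂, G₃, hG, ⟨⟨y, hy⟩, ⟨z, hz⟩, ⟨w, hw⟩⟩, hp⟩ :=
    b.exists_min_add_separated hB ⟨y₀, hy₀⟩ hΦ hΦm hκ0
  obtain ⟨c₁, k₁⟩ := hG G₁ (by simp)
  obtain ⟨c₂, k₂⟩ := hG G₂ (by simp)
  obtain ⟨c₃, k₃⟩ := hG G₃ (by simp)
  obtain ⟨a1, a2, a3⟩ := hpen (⟨y, hy⟩, ⟨z, hz⟩, ⟨w, hw⟩)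
  simp only at a1 a2 a3
  have htop : f₁ y + f₂ z + f₃ w + (A * b.gauge η (y - z) + A * b.gauge η (y - w) +
      τ * b.gauge ρ (y - y₀)) ≤ s₀ + 6 * κ := by
    have := hp (⟨y₀, hy₀⟩, ⟨y₀, hy₀⟩, ⟨y₀, hy₀⟩)
    simp only [Φ, sub_self, b.gauge_zero, mul_zero, add_zero] at this
    linarith [(k₁ y).1, (k₂ z).1, (k₃ w).1, (k₁ y₀).2.1, (k₂ y₀).2.1, (k₃ y₀).2.1]
  have hmy := (hm y hy).1
  have hmz := (hm z hz).2.1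
  have hmw := (hm w hw).2.2
  have hyz : ‖y - z‖ < η := by
    by_contra hcon
    rw [b.gauge_eq_one hη0 (not_lt.1 hcon), mul_one] at htop
    linarith
  have hyw : ‖y - w‖ < η := by
    by_contra hcon
    rw [b.gauge_eq_one hη0 (not_lt.1 hcon), mul_one] at htop
    linarith
  -- Moving `z` and `w` to `y` costs at most `2 * L * η ≤ τ / 4`, and the perturbations at most `6 *
  -- κ = τ / 8`; a full penalty `τ` would contradict minimality at `y₀`.
  have hyρ : ‖y - y₀‖ < ρ := by
    by_contra hcon
    rw [b.gauge_eq_one hρ0 (not_lt.1 hcon), mul_one] at htop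
    have e2 := (abs_le.1 ((h₂ y hy z hz).trans (mul_le_mul_of_nonneg_left hyz.le hL))).2
    have e3 := (abs_le.1 ((h₃ y hy w hw).trans (mul_le_mul_of_nonneg_left hyw.le hL))).2
    linarith [hmin y hy]
  have hηρ : η ≤ ρ := min_le_left _ _
  have h2ρ : 2 * ρ = min ε R := by rw [hρ]; ring
  have near : ∀ x, ‖y - x‖ < η → x ∈ Metric.ball y₀ (min ε R) := fun x hx => by
    rw [mem_ball_iff_norm]
    have : ‖x - y₀‖ ≤ ‖y - x‖ + ‖y - y₀‖ := by
      rw [norm_sub_rev y x]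
      simpa using norm_add_le (x - y) (y - y₀)
    linarith
  have hy' := near y (by simpa using hη0)
  have hz' := near z hyz
  have hw' := near w hyw
  have nhdsB : ∀ x ∈ Metric.ball y₀ (min ε R), B ∈ 𝓝 x := fun x hx =>
    mem_of_superset (Metric.isOpen_ball.mem_nhds hx)
      ((Metric.ball_subset_ball (min_le_right _ _)).trans Metric.ball_subset_closedBall)
  have dη := (b.gauge_contDiff η)
  have dρ := (b.gauge_contDiff ρ)
  refine ⟨y, z, w, hy', hz', hw', by linarith,
    fun x => -(A * b.gauge η (x - z) + A * b.gauge η (x - w) + τ * b.gauge ρ (x - y₀) + G₁ x),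
    fun x => -(A * b.gauge η (y - x) + G₂ x), fun x => -(A * b.gauge η (y - x) + G₃ x),
    by fun_prop, by fun_prop, by fun_prop, ?_, ?_, ?_, ?_⟩
  · filter_upwards [nhdsB y hy'] with x hx
    have := hp (⟨x, hx⟩, ⟨z, hz⟩, ⟨w, hw⟩)
    simp only [Φ] at this
    linarith
  · filter_upwards [nhdsB z hz'] with x hx
    have := hp (⟨y, hy⟩, ⟨x, hx⟩, ⟨w, hw⟩)
    simp only [Φ] at this
    linarith
  · filter_upwards [nhdsB w hw'] with x hx
    have := hp (⟨y, hy⟩, ⟨z, hz⟩, ⟨x, hx⟩)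
    simp only [Φ] at this
    linarith
  · have Dη := dη.differentiable one_ne_zero
    have Dρ := dρ.differentiable one_ne_zero
    have hsub : ∀ (r : ℝ) (a x : X), HasFDerivAt (fun x => b.gauge r (x - a))
        (fderiv ℝ (b.gauge r) (x - a)) x := fun r a x => by
      rw [← fderiv_comp_sub]
      have := (b.gauge_contDiff r).differentiable one_ne_zero
      exact DifferentiableAt.hasFDerivAt (by fun_prop)
    have hrev : ∀ a : X, HasFDerivAt (fun x => b.gauge η (y - x))
        (-fderiv ℝ (b.gauge η) (y - a)) a := fun a => by
      have := (Dη (y - a)).hasFDerivAt.comp a ((hasFDerivAt_id a).const_sub y)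
      rw [ContinuousLinearMap.comp_neg, ContinuousLinearMap.comp_id] at this
      exact this
    have D₁ := ((((hsub η z y).const_mul A).add ((hsub η w y).const_mul A)).add
      ((hsub ρ y₀ y).const_mul τ)).add (c₁.differentiable one_ne_zero y).hasFDerivAt |>.neg
    have D₂ := (((hrev z).const_mul A).add (c₂.differentiable one_ne_zero z).hasFDerivAt).neg
    have D₃ := (((hrev w).const_mul A).add (c₃.differentiable one_ne_zero w).hasFDerivAt).neg
    have E₁ := D₁.fderiv
    have E₂ := D₂.fderiv
    have E₃ := D₃.fderiv
    simp only [Pi.add_def, Pi.neg_def] at E₁ E₂ E₃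
    rw [E₁, E₂, E₃]
    have n1 := (k₁ y).2.2
    have n2 := (k₂ z).2.2
    have n3 := (k₃ w).2.2
    have n4 := b.norm_fderiv_gauge_le hρ0 (y - y₀)
    calc _ = ‖-(τ • fderiv ℝ (b.gauge ρ) (y - y₀) + fderiv ℝ G₁ y + fderiv ℝ G₂ z +
          fderiv ℝ G₃ w)‖ := by congr 1; module
      _ ≤ τ * (l * ρ⁻¹) + l * (2 * κ) + l * (2 * κ) + l * (2 * κ) := by
        rw [norm_neg]
        refine (norm_add_le _ _).trans (add_le_add ((norm_add_le _ _).trans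
          (add_le_add ((norm_add_le _ _).trans (add_le_add ?_ n1)) n2)) n3)
        rw [norm_smul, Real.norm_of_nonneg hτ0.le]
        gcongr
      _ ≤ τ * (1 + l * ρ⁻¹ + l) := by
        rw [hκ]
        nlinarith [mul_nonneg hτ0.le hl0]
      _ = ε := hτe

end
end BanachFinsler

/-! ### Speed of paths -/

namespace BanachFinsler
noncomputable section

open Filter Set MeasureTheory

namespace FinslerStructure

variable {X : Type*} [NormedAddCommGroup X] [NormedSpace ℝ X]
  {M : Type*} [TopologicalSpace M] [ChartedSpace X M] [IsManifold 𝓘(ℝ, X) 1 M]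
  (F : FinslerStructure X M)

theorem norm_zero (x : M) : F.norm ⟨x, (0 : TangentSpace 𝓘(ℝ, X) x)⟩ = 0 := by
  simpa using F.norm_smul x 0 0

/-- The speed of a path. -/
def speed (γ : ℝ → M) (t : ℝ) : ℝ := F.norm (tangentMap 𝓘(ℝ, ℝ) 𝓘(ℝ, X) γ ⟨t, (1 : ℝ)⟩)

theorem speed_nonneg (γ : ℝ → M) (t : ℝ) : 0 ≤ F.speed γ t := F.norm_nonneg _

theorem length_eq (γ : ℝ → M) (a b : ℝ) : F.length γ a b = ∫ t in a..b, F.speed γ t := rfl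

variable {F} in
theorem speed_congr {γ γ' : ℝ → M} {t : ℝ} (h : γ =ᶠ[𝓝 t] γ') : F.speed γ t = F.speed γ' t := by
  unfold speed
  congr 1
  exact Bundle.TotalSpace.ext h.eq_of_nhds (heq_of_eq (by
    change mfderiv 𝓘(ℝ, ℝ) 𝓘(ℝ, X) γ t (1 : ℝ) = mfderiv 𝓘(ℝ, ℝ) 𝓘(ℝ, X) γ' t (1 : ℝ)
    rw [h.mfderiv_eq]
    rfl))

theorem speed_comp_affine (γ : ℝ → M) {k : ℝ} (hk : k ≠ 0) (h t : ℝ) :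
    F.speed (fun t => γ (k * t + h)) t = |k| * F.speed γ (k * t + h) := by
  have hσ : HasDerivAt (fun t : ℝ => k * t + h) k t := by
    simpa using ((hasDerivAt_id t).const_mul k).add_const h
  by_cases hγ : MDifferentiableAt 𝓘(ℝ, ℝ) 𝓘(ℝ, X) γ (k * t + h)
  · unfold speed
    have e := tangentMap_comp_at (I := 𝓘(ℝ, ℝ)) (I' := 𝓘(ℝ, ℝ)) (I'' := 𝓘(ℝ, X))
      (f := fun t => k * t + h) (g := γ) ⟨t, (1 : ℝ)⟩ hγ
      hσ.differentiableAt.mdifferentiableAt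
    have e2 : tangentMap 𝓘(ℝ, ℝ) 𝓘(ℝ, ℝ) (fun t => k * t + h) ⟨t, (1 : ℝ)⟩ =
        ⟨k * t + h, (k • (1 : ℝ) : ℝ)⟩ := by
      simp only [tangentMap, mfderiv_eq_fderiv]
      congr 1
      change fderiv ℝ (fun t : ℝ => k * t + h) t (1 : ℝ) = k • (1 : ℝ)
      rw [hσ.hasFDerivAt.fderiv]
      simp
    rw [show (fun t => γ (k * t + h)) = γ ∘ (fun t => k * t + h) from rfl, e, e2,
      ← F.norm_smul]
    exact congrArg F.norm (Bundle.TotalSpace.ext rfl (heq_of_eq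
      ((mfderiv 𝓘(ℝ, ℝ) 𝓘(ℝ, X) γ (k * t + h)).map_smul k (1 : ℝ))))
  -- The affine change of parameter is invertible, so differentiability fails on both sides
  -- together, and both derivatives take the default value `0`.
  · have hγ' : ¬MDifferentiableAt 𝓘(ℝ, ℝ) 𝓘(ℝ, X) (fun t => γ (k * t + h)) t := fun H => by
      apply hγ
      have hinv : HasDerivAt (fun s : ℝ => k⁻¹ * (s - h)) k⁻¹ (k * t + h) := by
        simpa using ((hasDerivAt_id (k * t + h)).sub_const h).const_mul k⁻¹
      have hpt : k⁻¹ * (k * t + h - h) = t := by field_simp; ring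
      have := MDifferentiableAt.comp (I := 𝓘(ℝ, ℝ)) (I' := 𝓘(ℝ, ℝ)) (I'' := 𝓘(ℝ, X))
        (k * t + h) (f := fun s : ℝ => k⁻¹ * (s - h)) (g := fun t => γ (k * t + h))
        (by rw [hpt]; exact H) hinv.differentiableAt.mdifferentiableAt
      convert this using 1
      funext s
      simp only [Function.comp]
      congr 1
      field_simp
      ring
    unfold speed tangentMap
    rw [mfderiv_zero_of_not_mdifferentiableAt hγ, mfderiv_zero_of_not_mdifferentiableAt hγ']
    erw [F.norm_zero]
    simp

end FinslerStructure

namespace IsPiecewiseC1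

variable {X : Type*} [NormedAddCommGroup X] [NormedSpace ℝ X]
  {M : Type*} [TopologicalSpace M] [ChartedSpace X M] {γ : ℝ → M} {a b : ℝ}

theorem exists_finite_mdifferentiableAt (h : IsPiecewiseC1 X γ a b) :
    ∃ S : Set ℝ, S.Finite ∧ ∀ t ∈ Ioo a b \ S, MDifferentiableAt 𝓘(ℝ, ℝ) 𝓘(ℝ, X) γ t := by
  obtain ⟨-, -, n, s, hs, rfl, rfl, hc⟩ := h
  refine ⟨s '' Iic n, (finite_Iic n).image s, fun t ⟨ht, htS⟩ => ?_⟩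
  have hex : ∃ i, t < s i := ⟨n, ht.2⟩
  classical
  obtain ⟨i, hi⟩ : ∃ i, Nat.find hex = i + 1 := Nat.exists_eq_succ_of_ne_zero fun h0 => by
    have := Nat.find_spec hex
    rw [h0] at this
    exact absurd ht.1 this.not_gt
  have h1 : t < s (i + 1) := hi ▸ Nat.find_spec hex
  have h2 : s i ≤ t := not_lt.1 (Nat.find_min hex (by omega))
  have hin : i < n := by
    have := Nat.find_min' hex ht.2
    omega
  have h3 : s i < t := lt_of_le_of_ne h2 fun h => htS ⟨i, hin.le, h⟩
  exact ((hc i hin).contMDiffAt (Icc_mem_nhds h3 h1)).mdifferentiableAt one_ne_zero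

variable [IsManifold 𝓘(ℝ, X) 1 M]

/-- On the interior of each piece the speed equals that of the derivative within the closed piece,
which is continuous up to the endpoints. -/
theorem intervalIntegrable_speed (F : FinslerStructure X M) (h : IsPiecewiseC1 X γ a b) :
    IntervalIntegrable (F.speed γ) volume a b := by
  obtain ⟨-, -, n, s, hs, rfl, rfl, hc⟩ := h
  refine IntervalIntegrable.trans_iterate fun i hi => ?_
  -- Degenerate pieces are set aside because they lack unique differentiability.
  rcases (hs i.le_succ).eq_or_lt with heq | hlt
  · rw [heq]
  have hu : UniqueMDiffOn 𝓘(ℝ, ℝ) (Icc (s i) (s (i + 1))) :=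
    (uniqueDiffOn_Icc hlt).uniqueMDiffOn
  have c1 := (hc i hi).continuousOn_tangentMapWithin le_rfl hu
  have c2 : ContinuousOn (fun t => F.norm (tangentMapWithin 𝓘(ℝ, ℝ) 𝓘(ℝ, X) γ
      (Icc (s i) (s (i + 1))) ⟨t, (1 : ℝ)⟩)) (Icc (s i) (s (i + 1))) := by
    refine F.continuous_norm.comp_continuousOn (c1.comp ?_ fun t ht => ht)
    have : Continuous fun t : ℝ => ((tangentBundleModelSpaceHomeomorph 𝓘(ℝ, ℝ)).symm (t, (1 : ℝ))) :=
      (Homeomorph.continuous _).comp (by fun_prop)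
    exact this.continuousOn
  refine (c2.intervalIntegrable_of_Icc hlt.le).congr_uIoo fun t ht => ?_
  rw [uIoo_of_le hlt.le] at ht
  simp only [FinslerStructure.speed]
  rw [tangentMapWithin_eq_tangentMap (hu t (Ioo_subset_Icc_self ht))
    (((hc i hi).contMDiffAt (Icc_mem_nhds ht.1 ht.2)).mdifferentiableAt one_ne_zero)]

end IsPiecewiseC1

end
end BanachFinsler

/-! ### Concatenation of paths and the triangle inequality -/

namespace BanachFinsler
noncomputable section

open Filter Set MeasureTheory

namespace IsPiecewiseC1

variable {X : Type*} [NormedAddCommGroup X] [NormedSpace ℝ X]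
  {M : Type*} [TopologicalSpace M] [ChartedSpace X M] {γ γ' : ℝ → M} {a b c : ℝ}

/-- The factor `1 *` matches the shape of `speed_comp_affine`. -/
theorem comp_add (h : IsPiecewiseC1 X γ a b) (d : ℝ) :
    IsPiecewiseC1 X (fun t => γ (1 * t + d)) (a - d) (b - d) := by
  obtain ⟨hab, hcont, n, s, hs, rfl, rfl, hc⟩ := h
  have hmaps : ∀ x y : ℝ, MapsTo (fun t => 1 * t + d) (Icc (x - d) (y - d)) (Icc x y) :=
    fun x y t ht => ⟨by linarith [ht.1], by linarith [ht.2]⟩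
  have hsm : ContMDiff 𝓘(ℝ, ℝ) 𝓘(ℝ, ℝ) 1 fun t : ℝ => 1 * t + d :=
    ContDiff.contMDiff (by fun_prop)
  exact ⟨by linarith, hcont.comp hsm.continuous.continuousOn (hmaps _ _), n, fun i => s i - d,
    fun i j hij => sub_le_sub_right (hs hij) d, rfl, rfl,
    fun i hi => (hc i hi).comp hsm.contMDiffOn (hmaps _ _)⟩

theorem comp_neg (h : IsPiecewiseC1 X γ a b) :
    IsPiecewiseC1 X (fun t => γ (-1 * t + 0)) (-b) (-a) := by
  obtain ⟨hab, hcont, n, s, hs, rfl, rfl, hc⟩ := h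
  have hmaps : ∀ x y : ℝ, MapsTo (fun t => -1 * t + 0) (Icc (-y) (-x)) (Icc x y) :=
    fun x y t ht => ⟨by linarith [ht.2], by linarith [ht.1]⟩
  have hsm : ContMDiff 𝓘(ℝ, ℝ) 𝓘(ℝ, ℝ) 1 fun t : ℝ => -1 * t + 0 :=
    ContDiff.contMDiff (by fun_prop)
  -- Truncated subtraction makes the reversed subdivision constant past `n`, hence still monotone on
  -- all of `ℕ`.
  refine ⟨by linarith, hcont.comp hsm.continuous.continuousOn (hmaps _ _), n,
    fun i => -s (n - i), fun i j hij => neg_le_neg (hs (by omega)), by simp, by simp,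
    fun i hi => ?_⟩
  have e : n - i = (n - (i + 1)) + 1 := by omega
  beta_reduce
  rw [e]
  exact (hc _ (by omega)).comp hsm.contMDiffOn (hmaps _ _)

theorem trans (h : IsPiecewiseC1 X γ a b) (h' : IsPiecewiseC1 X γ' b c) (hb : γ b = γ' b) :
    IsPiecewiseC1 X (fun t => if t ≤ b then γ t else γ' t) a c := by
  obtain ⟨hab, hcont, n, s, hs, rfl, hsn, hc⟩ := h
  obtain ⟨hbc, hcont', n', s', hs', hs0', rfl, hc'⟩ := h'
  have eq1 : ∀ t ≤ b, (if t ≤ b then γ t else γ' t) = γ t := fun t ht => if_pos ht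
  have eq2 : ∀ t, b ≤ t → (if t ≤ b then γ t else γ' t) = γ' t := fun t ht => by
    rcases ht.eq_or_lt with rfl | h
    · simpa using hb
    · exact if_neg h.not_ge
  refine ⟨hab.trans hbc, ?_, n + n', fun i => if i ≤ n then s i else s' (i - n), ?_, by simp, ?_,
    fun i hi => ?_⟩
  · rw [← Icc_union_Icc_eq_Icc hab hbc]
    exact (hcont.congr fun t ht => eq1 t ht.2).union_of_isClosed
      (hcont'.congr fun t ht => eq2 t ht.1) isClosed_Icc isClosed_Icc
  · intro i j hij
    simp only
    split_ifs with h1 h2 h2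
    · exact hs hij
    · exact (hs h1).trans (hsn.le.trans (hs0'.ge.trans (hs' (Nat.zero_le _))))
    · omega
    · exact hs' (by omega)
  · rcases Nat.eq_zero_or_pos n' with rfl | hn'
    · simp [hsn, hs0']
    · simp [hn'.ne']
  · rcases lt_or_ge i n with h1 | h1
    · simp only [h1.le, Nat.succ_le_of_lt h1, if_true]
      exact (hc i h1).congr fun t ht => eq1 t (ht.2.trans ((hs h1).trans hsn.le))
    · have e : (if i ≤ n then s i else s' (i - n)) = s' (i - n) := by
        rcases h1.eq_or_lt with rfl | h1
        · simp [hsn, hs0']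
        · simp [h1.not_ge]
      beta_reduce
      rw [e, if_neg (by omega), show i + 1 - n = i - n + 1 by omega]
      exact (hc' (i - n) (by omega)).congr fun t ht =>
        eq2 t (hs0'.ge.trans ((hs' (Nat.zero_le _)).trans ht.1))

end IsPiecewiseC1

namespace FinslerStructure

variable {X : Type*} [NormedAddCommGroup X] [NormedSpace ℝ X]
  {M : Type*} [TopologicalSpace M] [ChartedSpace X M] [IsManifold 𝓘(ℝ, X) 1 M]
  (F : FinslerStructure X M)

/-- The set of lengths of the piecewise `C¹` paths joining two points. -/
def lengths (p q : M) : Set ℝ :=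
  {l : ℝ | ∃ (γ : ℝ → M) (a b : ℝ),
    IsPiecewiseC1 X γ a b ∧ γ a = p ∧ γ b = q ∧ l = F.length γ a b}

theorem dist_eq_sInf (p q : M) : F.dist p q = sInf (F.lengths p q) := rfl

theorem lengths_nonneg {p q : M} {l : ℝ} (hl : l ∈ F.lengths p q) : 0 ≤ l := by
  obtain ⟨γ, a, b, h, -, -, rfl⟩ := hl
  exact intervalIntegral.integral_nonneg h.1 fun t _ => F.speed_nonneg γ t

theorem bddBelow_lengths (p q : M) : BddBelow (F.lengths p q) :=
  ⟨0, fun _ hl => F.lengths_nonneg hl⟩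

theorem dist_nonneg (p q : M) : 0 ≤ F.dist p q :=
  Real.sInf_nonneg fun _ hl => F.lengths_nonneg hl

theorem dist_le {p q : M} {l : ℝ} (hl : l ∈ F.lengths p q) : F.dist p q ≤ l :=
  csInf_le (F.bddBelow_lengths p q) hl

theorem lengths_symm {p q : M} {l : ℝ} (hl : l ∈ F.lengths p q) : l ∈ F.lengths q p := by
  obtain ⟨γ, a, b, h, rfl, rfl, rfl⟩ := hl
  refine ⟨_, _, _, h.comp_neg, by simp, by simp, ?_⟩
  simp only [length_eq, F.speed_comp_affine γ (show (-1 : ℝ) ≠ 0 by norm_num)]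
  simp [intervalIntegral.integral_comp_neg (fun t => F.speed γ t)]

theorem dist_comm (p q : M) : F.dist p q = F.dist q p := by
  rw [dist_eq_sInf, dist_eq_sInf]
  congr 1
  exact Subset.antisymm (fun _ => F.lengths_symm) fun _ => F.lengths_symm

/-- The second path is shifted to start where the first ends. The glued path has the right speed off
the junction, which the integral ignores. -/
theorem lengths_add {p q r : M} {l l' : ℝ} (hl : l ∈ F.lengths p q) (hl' : l' ∈ F.lengths q r) :
    l + l' ∈ F.lengths p r := by
  obtain ⟨γ, a, b, h, rfl, rfl, rfl⟩ := hl
  obtain ⟨γ', a', b', h', ha', rfl, rfl⟩ := hl'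
  have h'' := h'.comp_add (a' - b)
  rw [sub_sub_cancel] at h''
  have hb : γ b = (fun t => γ' (1 * t + (a' - b))) b := by simp [ha']
  have H := h.trans h'' hb
  have eq1 : ∀ t < b, F.speed (fun t => if t ≤ b then γ t else γ' (1 * t + (a' - b))) t =
      F.speed γ t := fun t ht => speed_congr <| by
    filter_upwards [Iio_mem_nhds ht] with s hs using if_pos (mem_Iio.1 hs).le
  have eq2 : ∀ t > b, F.speed (fun t => if t ≤ b then γ t else γ' (1 * t + (a' - b))) t =
      F.speed γ' (t + (a' - b)) := fun t ht => by
    rw [speed_congr (γ' := fun t => γ' (1 * t + (a' - b)))]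
    · rw [F.speed_comp_affine γ' one_ne_zero]
      simp
    · filter_upwards [Ioi_mem_nhds ht] with s hs using if_neg (mem_Ioi.1 hs).not_ge
  refine ⟨_, _, _, H, by simp [h.1], ?_, ?_⟩
  -- This case occurs only when the second path has a one-point parameter interval.
  · by_cases hc : b' - (a' - b) ≤ b
    · have hab : a' = b' := le_antisymm h'.1 (by linarith)
      subst hab
      simp [ha']
    · simp only [if_neg hc]
      congr 1
      ring
  · have i1 := H.intervalIntegrable_speed F
    have hle : b ≤ b' - (a' - b) := h''.1
    rw [intervalIntegrable_iff_integrableOn_Ioc_of_le (h.1.trans hle)] at i1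
    have j1 : IntervalIntegrable (F.speed fun t => if t ≤ b then γ t else γ' (1 * t + (a' - b)))
        volume a b := (intervalIntegrable_iff_integrableOn_Ioc_of_le h.1).2
      (i1.mono_set (Ioc_subset_Ioc_right hle))
    have j2 : IntervalIntegrable (F.speed fun t => if t ≤ b then γ t else γ' (1 * t + (a' - b)))
        volume b (b' - (a' - b)) := (intervalIntegrable_iff_integrableOn_Ioc_of_le hle).2
      (i1.mono_set (Ioc_subset_Ioc_left h.1))
    simp only [length_eq]
    rw [← intervalIntegral.integral_add_adjacent_intervals j1 j2]
    congr 1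
    · refine intervalIntegral.integral_congr_uIoo fun t ht => ?_
      rw [uIoo_of_le h.1] at ht
      exact (eq1 t ht.2).symm
    · rw [intervalIntegral.integral_congr_Ioo_of_le hle fun t ht => eq2 t ht.1,
        intervalIntegral.integral_comp_add_right fun t => F.speed γ' t, add_sub_cancel,
        sub_add_cancel]

/-- Nonemptiness matters because the infimum of the empty set is `0` by default; connectedness
supplies it later, in `lengths_nonempty`. -/
theorem dist_triangle_of_nonempty {p q r : M} (h : (F.lengths p q).Nonempty)
    (h' : (F.lengths q r).Nonempty) : F.dist p r ≤ F.dist p q + F.dist q r := by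
  refine le_of_forall_pos_le_add fun ε hε => ?_
  obtain ⟨l, hl, hlt⟩ := exists_lt_of_csInf_lt h
    (show sInf (F.lengths p q) < F.dist p q + ε / 2 by rw [dist_eq_sInf]; linarith)
  obtain ⟨l', hl', hlt'⟩ := exists_lt_of_csInf_lt h'
    (show sInf (F.lengths q r) < F.dist q r + ε / 2 by rw [dist_eq_sInf]; linarith)
  have := F.dist_le (F.lengths_add hl hl')
  linarith

end FinslerStructure

end
end BanachFinsler

/-! ### Charts in which the Finsler norm is almost constant -/

namespace BanachFinsler
noncomputable section

open Filter Set MeasureTheory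

namespace FinslerStructure

variable {X : Type*} [NormedAddCommGroup X] [NormedSpace ℝ X]
  {M : Type*} [TopologicalSpace M] [ChartedSpace X M] [IsManifold 𝓘(ℝ, X) 1 M]
  (F : FinslerStructure X M) (φ : OpenPartialHomeomorph M X)

/-- The Finsler norm read in a chart. -/
def chartNorm (y v : X) : ℝ := F.norm (tangentMap 𝓘(ℝ, X) 𝓘(ℝ, X) φ.symm ⟨y, v⟩)

theorem chartNorm_nonneg (y v : X) : 0 ≤ F.chartNorm φ y v := F.norm_nonneg _

theorem chartNorm_add_le (y v w : X) :
    F.chartNorm φ y (v + w) ≤ F.chartNorm φ y v + F.chartNorm φ y w := by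
  refine le_of_eq_of_le (congrArg F.norm ?_) (F.norm_add_le (φ.symm y)
    (mfderiv 𝓘(ℝ, X) 𝓘(ℝ, X) φ.symm y v) (mfderiv 𝓘(ℝ, X) 𝓘(ℝ, X) φ.symm y w))
  exact Bundle.TotalSpace.ext rfl (heq_of_eq
    ((mfderiv 𝓘(ℝ, X) 𝓘(ℝ, X) φ.symm y).map_add v w))

theorem chartNorm_smul (y : X) (c : ℝ) (v : X) :
    F.chartNorm φ y (c • v) = |c| * F.chartNorm φ y v := by
  refine Eq.trans (congrArg F.norm ?_) (F.norm_smul (φ.symm y) c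
    (mfderiv 𝓘(ℝ, X) 𝓘(ℝ, X) φ.symm y v))
  exact Bundle.TotalSpace.ext rfl (heq_of_eq
    ((mfderiv 𝓘(ℝ, X) 𝓘(ℝ, X) φ.symm y).map_smul c v))

theorem chartNorm_sub_comm (y v w : X) : F.chartNorm φ y (v - w) = F.chartNorm φ y (w - v) := by
  have := F.chartNorm_smul φ y (-1) (w - v)
  simpa using this

theorem speed_symm_comp (hφ : φ ∈ IsManifold.maximalAtlas 𝓘(ℝ, X) 1 M) {c : ℝ → X} {c' : X}
    {t : ℝ} (hc : HasDerivAt c c' t) (ht : c t ∈ φ.target) :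
    F.speed (φ.symm ∘ c) t = F.chartNorm φ (c t) c' := by
  have e := tangentMap_comp_at (I := 𝓘(ℝ, ℝ)) (I' := 𝓘(ℝ, X)) (I'' := 𝓘(ℝ, X))
    (f := c) (g := φ.symm) ⟨t, (1 : ℝ)⟩ (mdifferentiableAt_symm_of_mem_maximalAtlas hφ ht)
    hc.differentiableAt.mdifferentiableAt
  have e2 : tangentMap 𝓘(ℝ, ℝ) 𝓘(ℝ, X) c ⟨t, (1 : ℝ)⟩ = ⟨c t, c'⟩ := by
    simp only [tangentMap, mfderiv_eq_fderiv]
    congr 1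
    change fderiv ℝ c t (1 : ℝ) = c'
    rw [hc.hasFDerivAt.fderiv]
    simp
  unfold speed chartNorm
  rw [e, e2]

/-- A closed ball in the target of a chart on which the Finsler norm is almost constant, and
whose closed subsets correspond to closed subsets of the manifold. -/
structure IsGoodBall (y₀ : X) (δ r : ℝ) : Prop where
  mem_atlas : φ ∈ IsManifold.maximalAtlas 𝓘(ℝ, X) 1 M
  nonneg : 0 ≤ δ
  pos : 0 < r
  subset : Metric.closedBall y₀ r ⊆ φ.target
  isClosed : ∀ C ⊆ Metric.closedBall y₀ r, IsClosed C → IsClosed (φ.symm '' C)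
  lower : ∀ y ∈ Metric.closedBall y₀ r, ∀ v,
    F.chartNorm φ y₀ v ≤ (1 + δ) * F.chartNorm φ y v
  upper : ∀ y ∈ Metric.closedBall y₀ r, ∀ v,
    F.chartNorm φ y v ≤ (1 + δ) * F.chartNorm φ y₀ v

theorem exists_chartNorm_equiv (hφ : φ ∈ IsManifold.maximalAtlas 𝓘(ℝ, X) 1 M) {y : X}
    (hy : y ∈ φ.target) :
    ∃ K : ℝ, 1 ≤ K ∧ ∀ v, ‖v‖ ≤ K * F.chartNorm φ y v ∧ F.chartNorm φ y v ≤ K * ‖v‖ := by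
  obtain ⟨K, hK, h⟩ := F.equivalent_norm φ hφ (φ.symm y) (φ.map_target hy)
  rw [φ.right_inv hy] at h
  have hK0 : 0 < K := by linarith
  exact ⟨K, hK, fun v => ⟨(inv_mul_le_iff₀ hK0).1 (h v).1, (h v).2⟩⟩

variable {φ} in
-- A paracompact Hausdorff space is regular, so the Palais neighbourhood contains a closed
-- neighbourhood `V`. Inside it, the image of a closed set `C` is `V ∩ φ ⁻¹' C`, which is closed in
-- `M`.
theorem exists_isGoodBall [T2Space M] [ParacompactSpace M]
    (hφ : φ ∈ IsManifold.maximalAtlas 𝓘(ℝ, X) 1 M) {x₀ : M} (hx₀ : x₀ ∈ φ.source) {δ : ℝ}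
    (hδ : 0 < δ) {U : Set M} (hU : U ∈ 𝓝 x₀) :
    ∃ r, F.IsGoodBall φ (φ x₀) δ r ∧ φ.symm '' Metric.closedBall (φ x₀) r ⊆ U := by
  obtain ⟨W, hWo, hxW, hWs, hW⟩ := F.palais φ hφ x₀ hx₀ δ hδ
  obtain ⟨V, ⟨hV, hVc⟩, hVs⟩ := (closed_nhds_basis x₀).mem_iff.1
    (inter_mem (hWo.mem_nhds hxW) hU)
  have h1 : φ.symm ⁻¹' V ∩ φ.target ∈ 𝓝 (φ x₀) := by
    refine inter_mem ?_ (φ.open_target.mem_nhds (φ.map_source hx₀))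
    exact (φ.continuousAt_symm (φ.map_source hx₀)).preimage_mem_nhds (by rwa [φ.left_inv hx₀])
  obtain ⟨r, hr, hrs⟩ := Metric.nhds_basis_closedBall.mem_iff.1 h1
  have hVW : ∀ y ∈ Metric.closedBall (φ x₀) r, φ.symm y ∈ W := fun y hy => (hVs (hrs hy).1).1
  have hδ1 : 0 < 1 + δ := by linarith
  refine ⟨r, ⟨hφ, hδ.le, hr, fun y hy => (hrs hy).2, fun C hC hCc => ?_, fun y hy v => ?_,
    fun y hy v => ?_⟩, ?_⟩
  · have : φ.symm '' C = V ∩ φ ⁻¹' C := by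
      ext x
      constructor
      · rintro ⟨y, hy, rfl⟩
        exact ⟨(hrs (hC hy)).1, by rw [mem_preimage, φ.right_inv (hrs (hC hy)).2]; exact hy⟩
      · rintro ⟨hxV, hxC⟩
        exact ⟨φ x, hxC, φ.left_inv (hWs (hVs hxV).1)⟩
    rw [this]
    exact (φ.continuousOn.mono fun x hx => hWs (hVs hx).1).preimage_isClosed_of_isClosed hVc hCc
  · have := (hW (φ.symm y) (hVW y hy) v).1
    rw [φ.right_inv (hrs hy).2] at this
    exact (inv_mul_le_iff₀ hδ1).1 this
  · have := (hW (φ.symm y) (hVW y hy) v).2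
    rwa [φ.right_inv (hrs hy).2] at this
  · rintro _ ⟨y, hy, rfl⟩
    exact (hVs (hrs hy).1).2

namespace IsGoodBall

variable {F φ} {y₀ : X} {δ r : ℝ} (h : F.IsGoodBall φ y₀ δ r)
include h

theorem center_mem : y₀ ∈ Metric.closedBall y₀ r := Metric.mem_closedBall_self h.pos.le

/-- The straight segment in the chart stays in the convex ball, where its speed is controlled by the
norm at the centre. -/
theorem exists_mem_lengths {y z : X} (hy : y ∈ Metric.closedBall y₀ r)
    (hz : z ∈ Metric.closedBall y₀ r) :
    ∃ l ∈ F.lengths (φ.symm y) (φ.symm z), l ≤ (1 + δ) * F.chartNorm φ y₀ (y - z) := by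
  let c : ℝ → X := fun t => y + t • (z - y)
  have hc : ∀ t, HasDerivAt c (z - y) t := fun t => by
    have := ((hasDerivAt_id t).smul_const (z - y)).const_add y
    rw [one_smul] at this
    exact this
  have hmem : ∀ t ∈ Icc (0 : ℝ) 1, c t ∈ Metric.closedBall y₀ r := fun t ht =>
    (convex_closedBall y₀ r).add_smul_sub_mem hy hz ht
  have hsm : ContMDiffOn 𝓘(ℝ, ℝ) 𝓘(ℝ, X) 1 (φ.symm ∘ c) (Icc 0 1) :=
    (contMDiffOn_symm_of_mem_maximalAtlas h.mem_atlas).comp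
      (ContDiff.contMDiff (by fun_prop : ContDiff ℝ 1 c)).contMDiffOn
      fun t ht => h.subset (hmem t ht)
  refine ⟨F.length (φ.symm ∘ c) 0 1, ⟨φ.symm ∘ c, 0, 1, ⟨zero_le_one, hsm.continuousOn, 1,
    fun i => min (i : ℝ) 1, fun i j hij => min_le_min_right _ (by exact_mod_cast hij), by simp,
    by simp, fun i hi => ?_⟩, by simp [c], by simp [c], rfl⟩, ?_⟩
  · obtain rfl : i = 0 := by omega
    simpa using hsm
  · have := intervalIntegral.norm_integral_le_of_norm_le_const (a := 0) (b := 1)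
      (f := F.speed (φ.symm ∘ c)) (C := (1 + δ) * F.chartNorm φ y₀ (y - z)) fun t ht => by
        rw [uIoc_of_le zero_le_one] at ht
        have ht' := hmem t ⟨ht.1.le, ht.2⟩
        rw [Real.norm_of_nonneg (F.speed_nonneg _ _),
          F.speed_symm_comp φ h.mem_atlas (hc t) (h.subset ht'), F.chartNorm_sub_comm φ y₀]
        exact h.upper _ ht' _
    rw [sub_zero, abs_one, mul_one] at this
    exact (le_abs_self _).trans this

theorem dist_le {y z : X} (hy : y ∈ Metric.closedBall y₀ r)
    (hz : z ∈ Metric.closedBall y₀ r) :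
    F.dist (φ.symm y) (φ.symm z) ≤ (1 + δ) * F.chartNorm φ y₀ (y - z) := by
  obtain ⟨l, hl, hle⟩ := h.exists_mem_lengths hy hz
  exact (F.dist_le hl).trans hle

/-- The fundamental theorem of calculus, valid off the finitely many break points, applied to the
path read in the chart, whose velocity is dominated by the Finsler speed. -/
theorem norm_sub_le_integral_speed [CompleteSpace X] {K : ℝ} (hK : 0 ≤ K)
    (hKv : ∀ v, ‖v‖ ≤ K * F.chartNorm φ y₀ v) {γ : ℝ → M} {a b t : ℝ}
    (hγ : IsPiecewiseC1 X γ a b) (ht : t ∈ Icc a b)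
    (hmem : ∀ s ∈ Icc a t, γ s ∈ φ.symm '' Metric.closedBall y₀ r) :
    ‖φ (γ t) - φ (γ a)‖ ≤ K * (1 + δ) * ∫ s in a..t, F.speed γ s := by
  have hsrc : ∀ s ∈ Icc a t, γ s ∈ φ.source := fun s hs => by
    obtain ⟨y, hy, e⟩ := hmem s hs
    exact e ▸ φ.map_target (h.subset hy)
  have hball : ∀ s ∈ Icc a t, φ (γ s) ∈ Metric.closedBall y₀ r := fun s hs => by
    obtain ⟨y, hy, e⟩ := hmem s hs
    rwa [← e, φ.right_inv (h.subset hy)]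
  have hsub : Icc a t ⊆ Icc a b := Icc_subset_Icc_right ht.2
  have hcont : ContinuousOn (φ ∘ γ) (Icc a t) := φ.continuousOn.comp (hγ.2.1.mono hsub) hsrc
  obtain ⟨S, hS, hd⟩ := hγ.exists_finite_mdifferentiableAt
  have hderiv : ∀ s ∈ Ioo a t \ S, HasDerivAt (φ ∘ γ) (deriv (φ ∘ γ) s) s ∧
      ‖deriv (φ ∘ γ) s‖ ≤ K * (1 + δ) * F.speed γ s := fun s hs => by
    have hs' : s ∈ Icc a t := Ioo_subset_Icc_self hs.1
    have d1 := hd s ⟨⟨hs.1.1, hs.1.2.trans_le ht.2⟩, hs.2⟩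
    have d2 : MDifferentiableAt 𝓘(ℝ, X) 𝓘(ℝ, X) φ (γ s) :=
      mdifferentiableAt_of_mem_maximalAtlas h.mem_atlas (hsrc s hs')
    have d3 : HasDerivAt (φ ∘ γ) (deriv (φ ∘ γ) s) s :=
      (mdifferentiableAt_iff_differentiableAt.1 (d2.comp s d1)).hasDerivAt
    refine ⟨d3, ?_⟩
    have hev : γ =ᶠ[𝓝 s] φ.symm ∘ (φ ∘ γ) := by
      filter_upwards [d1.continuousAt.preimage_mem_nhds
        (φ.open_source.mem_nhds (hsrc s hs'))] with τ hτ
      exact (φ.left_inv hτ).symm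
    rw [speed_congr hev, F.speed_symm_comp φ h.mem_atlas d3 (φ.map_source (hsrc s hs')), mul_assoc]
    exact (hKv _).trans (mul_le_mul_of_nonneg_left (h.lower _ (hball s hs') _) hK)
  have hae : ∀ᵐ s ∂volume, s ∈ Ioc a t → ‖deriv (φ ∘ γ) s‖ ≤ K * (1 + δ) * F.speed γ s := by
    have hfin : ∀ᵐ s ∂(volume : Measure ℝ), s ∉ S ∪ {t} :=
      (hS.union (finite_singleton t)).measure_zero volume |> measure_eq_zero_iff_ae_notMem.1
    filter_upwards [hfin] with s hs hst
    simp only [mem_union, mem_singleton_iff, not_or] at hs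
    exact (hderiv s ⟨⟨hst.1, lt_of_le_of_ne hst.2 hs.2⟩, hs.1⟩).2
  have hint : IntervalIntegrable (fun s => K * (1 + δ) * F.speed γ s) volume a t := by
    have := (hγ.intervalIntegrable_speed F).const_mul (K * (1 + δ))
    exact this.mono_set (by rw [uIcc_of_le ht.1, uIcc_of_le hγ.1]; exact hsub)
  have hint' : IntervalIntegrable (deriv (φ ∘ γ)) volume a t := by
    refine hint.mono_fun' (aestronglyMeasurable_deriv _ _) ?_
    rw [uIoc_of_le ht.1]
    exact (ae_restrict_iff' measurableSet_Ioc).2 hae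
  have ftc := integral_eq_of_hasDerivAt_off_countable_of_le (φ ∘ γ) (deriv (φ ∘ γ)) ht.1
    hS.countable hcont (fun s hs => (hderiv s hs).1) hint'
  have := intervalIntegral.norm_integral_le_of_norm_le ht.1 hae hint
  rw [ftc, intervalIntegral.integral_const_mul] at this
  exact this

/-- A first-exit argument. Before the first time outside the open ball of radius `s`, the length
bound keeps the path in a closed ball of radius `s' < s`. The image of that ball is closed in `M`,
so the exit point lies in it too, a contradiction. -/
theorem mem_of_mem_lengths [CompleteSpace X] {K : ℝ} (hK : 0 ≤ K)
    (hKv : ∀ v, ‖v‖ ≤ K * F.chartNorm φ y₀ v) {q : M} {l s : ℝ}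
    (hl : l ∈ F.lengths (φ.symm y₀) q) (hs : s ≤ r) (hls : K * (1 + δ) * l < s) :
    q ∈ φ.symm '' Metric.ball y₀ s := by
  obtain ⟨γ, a, b, hγ, ha, rfl, rfl⟩ := hl
  set s' := K * (1 + δ) * F.length γ a b with hs'
  have hδ1 : 0 ≤ K * (1 + δ) := mul_nonneg hK (by linarith [h.nonneg])
  have hl0 : 0 ≤ F.length γ a b :=
    intervalIntegral.integral_nonneg hγ.1 fun t _ => F.speed_nonneg γ t
  have hs'0 : 0 ≤ s' := mul_nonneg hδ1 hl0
  set O := φ.symm '' Metric.ball y₀ s with hO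
  have hballs : Metric.ball y₀ s ⊆ Metric.closedBall y₀ r :=
    Metric.ball_subset_closedBall.trans (Metric.closedBall_subset_closedBall hs)
  have hOo : IsOpen O :=
    φ.isOpen_image_symm_of_subset_target Metric.isOpen_ball (hballs.trans h.subset)
  have haO : γ a ∈ O := ⟨y₀, Metric.mem_ball_self (hs'0.trans_lt hls), ha.symm⟩
  by_contra hb
  set T := Icc a b ∩ γ ⁻¹' Oᶜ with hT
  have hTc : IsClosed T := hγ.2.1.preimage_isClosed_of_isClosed isClosed_Icc hOo.isClosed_compl
  have hTne : T.Nonempty := ⟨b, right_mem_Icc.2 hγ.1, hb⟩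
  have hTbd : BddBelow T := ⟨a, fun t ht => ht.1.1⟩
  have htT : sInf T ∈ T := hTc.csInf_mem hTne hTbd
  set t := sInf T with ht
  have hat : a < t := lt_of_le_of_ne htT.1.1 fun e => htT.2 (e ▸ haO)
  have hbefore : ∀ τ ∈ Ico a t, γ τ ∈ O := fun τ hτ => by
    by_contra hcon
    exact (csInf_le hTbd ⟨⟨hτ.1, hτ.2.le.trans htT.1.2⟩, hcon⟩).not_gt hτ.2
  have hclosed : IsClosed (φ.symm '' Metric.closedBall y₀ s') :=
    h.isClosed _ (Metric.closedBall_subset_closedBall (hls.le.trans hs)) Metric.isClosed_closedBall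
  have hmaps : MapsTo γ (Ico a t) (φ.symm '' Metric.closedBall y₀ s') := fun τ hτ => by
    have hτb : τ ∈ Icc a b := ⟨hτ.1, hτ.2.le.trans htT.1.2⟩
    have hO' : ∀ σ ∈ Icc a τ, γ σ ∈ φ.symm '' Metric.closedBall y₀ r := fun σ hσ =>
      image_mono hballs (hbefore σ ⟨hσ.1, hσ.2.trans_lt hτ.2⟩)
    have key := h.norm_sub_le_integral_speed hK hKv hγ hτb hO'
    have hle : ∫ σ in a..τ, F.speed γ σ ≤ F.length γ a b := by
      rw [length_eq]
      exact intervalIntegral.integral_mono_interval le_rfl hτ.1 hτb.2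
        (Eventually.of_forall fun σ => F.speed_nonneg γ σ) (hγ.intervalIntegrable_speed F)
    rw [ha, φ.right_inv (h.subset h.center_mem)] at key
    obtain ⟨y, hy, e⟩ := hbefore τ hτ
    have hy' : y ∈ φ.target := h.subset (hballs hy)
    rw [← e, φ.right_inv hy'] at key
    refine ⟨y, ?_, e⟩
    rw [mem_closedBall_iff_norm]
    exact key.trans (mul_le_mul_of_nonneg_left hle hδ1)
  have hcl : t ∈ closure (Ico a t) := by
    rw [closure_Ico hat.ne]
    exact right_mem_Icc.2 hat.le
  have hcw : ContinuousWithinAt γ (Ico a t) t :=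
    (hγ.2.1 t htT.1).mono fun τ hτ => ⟨hτ.1, hτ.2.le.trans htT.1.2⟩
  have := hcw.mem_closure hcl hmaps
  rw [hclosed.closure_eq] at this
  exact htT.2 (image_mono (Metric.closedBall_subset_ball hls) this)

end IsGoodBall

end FinslerStructure

end
end BanachFinsler

/-! ### The Finsler metric, the manifold topology and Ekeland's principle -/

namespace BanachFinsler
noncomputable section

open Filter Set

namespace FinslerStructure

variable {X : Type*} [NormedAddCommGroup X] [NormedSpace ℝ X]
  {M : Type*} [TopologicalSpace M] [ChartedSpace X M] [IsManifold 𝓘(ℝ, X) 1 M]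
  (F : FinslerStructure X M)

theorem exists_chartAt_equiv (x : M) : ∃ K : ℝ, 1 ≤ K ∧ ∀ v,
    ‖v‖ ≤ K * F.chartNorm (chartAt X x) (chartAt X x x) v ∧
      F.chartNorm (chartAt X x) (chartAt X x x) v ≤ K * ‖v‖ :=
  F.exists_chartNorm_equiv _ (IsManifold.chart_mem_maximalAtlas x) (mem_chart_target X x)

variable {F} in
theorem IsGoodBall.image_ball_mem_nhds {φ : OpenPartialHomeomorph M X} {x : M} {δ r : ℝ}
    (hx : x ∈ φ.source) (h : F.IsGoodBall φ (φ x) δ r) {s : ℝ} (hs : 0 < s) (hsr : s ≤ r) :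
    φ.symm '' Metric.ball (φ x) s ∈ 𝓝 x :=
  (φ.isOpen_image_symm_of_subset_target Metric.isOpen_ball (Metric.ball_subset_closedBall.trans
    ((Metric.closedBall_subset_closedBall hsr).trans h.subset))).mem_nhds
    ⟨φ x, Metric.mem_ball_self hs, φ.left_inv hx⟩

variable [T2Space M] [ParacompactSpace M]

theorem exists_isGoodBall_chartAt (x : M) {δ : ℝ} (hδ : 0 < δ) {U : Set M} (hU : U ∈ 𝓝 x) :
    ∃ r, F.IsGoodBall (chartAt X x) (chartAt X x x) δ r ∧
      (chartAt X x).symm '' Metric.closedBall (chartAt X x x) r ⊆ U :=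
  F.exists_isGoodBall (IsManifold.chart_mem_maximalAtlas x) (mem_chart_source X x) hδ hU

theorem eventually_lengths (x : M) :
    ∀ᶠ y in 𝓝 x, (F.lengths x y).Nonempty := by
  obtain ⟨r, h, -⟩ := F.exists_isGoodBall_chartAt x one_pos univ_mem
  filter_upwards [h.image_ball_mem_nhds (mem_chart_source X x) h.pos le_rfl] with y hy
  obtain ⟨z, hz, rfl⟩ := hy
  obtain ⟨l, hl, -⟩ := h.exists_mem_lengths h.center_mem (Metric.ball_subset_closedBall hz)
  rw [(chartAt X x).left_inv (mem_chart_source X x)] at hl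
  exact ⟨l, hl⟩

theorem tendsto_dist_self (x : M) : Tendsto (fun y => F.dist y x) (𝓝 x) (𝓝 0) := by
  obtain ⟨r, h, -⟩ := F.exists_isGoodBall_chartAt x one_pos univ_mem
  obtain ⟨K, hK, hKv⟩ := F.exists_chartAt_equiv x
  have hx := mem_chart_source X x
  have hc : Tendsto (fun y => 2 * (K * ‖chartAt X x y - chartAt X x x‖)) (𝓝 x) (𝓝 0) := by
    have h1 : Tendsto (fun y => chartAt X x y - chartAt X x x) (𝓝 x) (𝓝 0) := by
      simpa using ((chartAt X x).continuousAt hx).sub_const (chartAt X x x)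
    simpa using (h1.norm.const_mul K).const_mul 2
  refine tendsto_of_tendsto_of_tendsto_of_le_of_le' tendsto_const_nhds hc
    (Eventually.of_forall fun y => F.dist_nonneg y x) ?_
  filter_upwards [h.image_ball_mem_nhds hx h.pos le_rfl] with y hy
  obtain ⟨z, hz, rfl⟩ := hy
  have hz' := Metric.ball_subset_closedBall hz
  have := h.dist_le hz' h.center_mem
  rw [(chartAt X x).left_inv hx] at this
  rw [(chartAt X x).right_inv (h.subset hz')]
  refine this.trans ?_
  rw [one_add_one_eq_two]
  exact mul_le_mul_of_nonneg_left (hKv _).2 zero_le_two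

theorem dist_self (x : M) : F.dist x x = 0 :=
  tendsto_nhds_unique (tendsto_pure_nhds (fun y => F.dist y x) x)
    ((F.tendsto_dist_self x).mono_left (pure_le_nhds x))

variable [ConnectedSpace M]

/-- The points reachable from `p` form a clopen set, since nearby points are joined by chart
segments. -/
theorem lengths_nonempty (p q : M) : (F.lengths p q).Nonempty := by
  have hclopen : IsClopen {q | (F.lengths p q).Nonempty} := by
    constructor
    · rw [← isOpen_compl_iff, isOpen_iff_mem_nhds]
      intro q hq
      filter_upwards [F.eventually_lengths q] with y ⟨l, hl⟩ ⟨l', hl'⟩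
      exact hq ⟨_, F.lengths_add hl' (F.lengths_symm hl)⟩
    · rw [isOpen_iff_mem_nhds]
      rintro q ⟨l, hl⟩
      filter_upwards [F.eventually_lengths q] with y ⟨l', hl'⟩
      exact ⟨_, F.lengths_add hl hl'⟩
  have := hclopen.eq_univ ⟨p, (F.eventually_lengths p).self_of_nhds⟩
  exact this.ge (mem_univ q)

theorem dist_triangle (p q r : M) : F.dist p r ≤ F.dist p q + F.dist q r :=
  F.dist_triangle_of_nonempty (F.lengths_nonempty p q) (F.lengths_nonempty q r)

theorem continuous_dist_right (y : M) : Continuous fun x => F.dist x y := by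
  refine continuous_iff_continuousAt.2 fun x => ?_
  rw [ContinuousAt, tendsto_iff_dist_tendsto_zero]
  refine squeeze_zero (fun _ => _root_.dist_nonneg) (fun z => ?_) (F.tendsto_dist_self x)
  rw [Real.dist_eq, abs_le]
  have h1 := F.dist_triangle x z y
  have h2 := F.dist_triangle z x y
  rw [F.dist_comm x z] at h1
  constructor <;> linarith

/-- Short paths cannot leave a good ball. This turns metric completeness into convergence in the
topology of `M`. -/
theorem exists_dist_lt_imp_mem [CompleteSpace X] {x : M} {U : Set M} (hU : U ∈ 𝓝 x) :
    ∃ ε > 0, ∀ y, F.dist x y < ε → y ∈ U := by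
  obtain ⟨r, h, hr⟩ := F.exists_isGoodBall_chartAt x one_pos hU
  obtain ⟨K, hK, hKv⟩ := F.exists_chartAt_equiv x
  have hK0 : 0 < K := by linarith
  have hr0 := h.pos
  refine ⟨r / (K * (1 + 1)), by positivity, fun y hy => ?_⟩
  obtain ⟨l, hl, hlt⟩ := exists_lt_of_csInf_lt (F.lengths_nonempty x y) hy
  rw [← (chartAt X x).left_inv (mem_chart_source X x)] at hl
  have := h.mem_of_mem_lengths hK0.le (fun v => (hKv v).1) hl le_rfl
    (by rw [lt_div_iff₀ (by positivity)] at hlt; linarith)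
  exact hr (image_mono Metric.ball_subset_closedBall this)

/-- Ekeland's variational principle for the Finsler metric. -/
theorem exists_ekeland [CompleteSpace X] (hF : F.IsComplete) {Φ : M → ℝ}
    (hΦ : LowerSemicontinuous Φ) {m : ℝ} (hm : ∀ z, m ≤ Φ z) {ε : ℝ} (hε : 0 < ε) :
    ∃ x, (∀ z, Φ x ≤ Φ z + ε) ∧ ∀ z, Φ x ≤ Φ z + ε * F.dist z x := by
  -- Paired with the gauges `2 ^ i * F.dist`, these weights give a total slope `∑ δ i * 2 ^ i = ε`.
  let δ : ℕ → ℝ := fun i => ε / 2 * (1 / 4) ^ i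
  have hδ : ∀ i, 0 < δ i := fun i => by positivity
  have hs : Summable δ :=
    (summable_geometric_of_lt_one (by norm_num) (by norm_num)).mul_left _
  have hs' : HasSum (fun i => δ i * 2 ^ i) ε := by
    have h : (fun i => δ i * 2 ^ i) = fun i => ε / 2 * (1 / 2) ^ i := funext fun i => by
      simp only [δ]
      rw [mul_assoc, ← mul_pow]
      norm_num
    rw [h]
    have := (hasSum_geometric_of_lt_one (r := (1 / 2 : ℝ)) (by norm_num)
      (by norm_num)).mul_left (ε / 2)
    rwa [show ε / 2 * (1 - 1 / 2)⁻¹ = ε by norm_num] at this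
  obtain ⟨c, x, hx, h1, h2⟩ := exists_min_add_tsum_gauge hΦ hm
    (ρ := fun i x y => 2 ^ i * F.dist x y)
    (fun i x y => mul_nonneg (by positivity) (F.dist_nonneg x y))
    (fun i x => by simp [F.dist_self])
    (fun i y => ((F.continuous_dist_right y).const_mul _).lowerSemicontinuous)
    (fun s hS => by
      have hS' : ∀ i j, i ≤ j → F.dist (s j) (s i) < (1 / 2) ^ i := fun i j hij => by
        rcases hij.eq_or_lt with rfl | hij
        · rw [F.dist_self]; positivity
        · rw [one_div, inv_pow, ← mul_one (2 ^ i : ℝ)⁻¹, lt_inv_mul_iff₀ (by positivity)]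
          exact hS i j hij
      obtain ⟨x, hx⟩ := hF s fun ε hε => by
        obtain ⟨N, hN⟩ := exists_pow_lt_of_lt_one (half_pos hε) (show (1 / 2 : ℝ) < 1 by norm_num)
        refine ⟨N, fun m hm n hn => ?_⟩
        have t1 := hS' N m hm
        have t2 := hS' N n hn
        have t3 := F.dist_triangle (s m) (s N) (s n)
        rw [F.dist_comm (s N)] at t3
        linarith
      refine ⟨x, fun U hU => ?_⟩
      obtain ⟨ε, hε, hU⟩ := F.exists_dist_lt_imp_mem hU
      obtain ⟨N, hN⟩ := hx ε hε
      change ∀ᶠ n in atTop, s n ∈ U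
      filter_upwards [eventually_ge_atTop N] with n hn
      exact hU _ (F.dist_comm _ _ ▸ hN n hn)) hδ hs
  refine ⟨x, fun z => (h1 z).trans ?_, fun z => ?_⟩
  · simp only [δ, pow_zero, mul_one]
    linarith
  · have sx : Summable fun i => δ i * (2 ^ i * F.dist x (c i)) :=
      Summable.of_nonneg_of_le
        (fun i => mul_nonneg (hδ i).le (mul_nonneg (by positivity) (F.dist_nonneg _ _)))
        (fun i => mul_le_of_le_one_right (hδ i).le (hx i).le) hs
    have su := sx.hasSum.add (hs'.mul_right (F.dist z x))
    -- The triangle inequality through `x` replaces the whole series by the single term `ε * F.dist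
    -- z x`, and gives the summability at `z` that the unbounded gauges do not provide.
    have le : ∀ i, δ i * (2 ^ i * F.dist z (c i)) ≤
        δ i * (2 ^ i * F.dist x (c i)) + δ i * 2 ^ i * F.dist z x := fun i => by
      have := mul_le_mul_of_nonneg_left (F.dist_triangle z x (c i))
        (show 0 ≤ δ i * 2 ^ i by have := hδ i; positivity)
      linarith
    have sz : Summable fun i => δ i * (2 ^ i * F.dist z (c i)) :=
      Summable.of_nonneg_of_le
        (fun i => mul_nonneg (hδ i).le (mul_nonneg (by positivity) (F.dist_nonneg _ _)))
        le su.summable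
    have t1 := h2 z sz
    have t2 := sz.tsum_le_tsum le su.summable
    rw [su.tsum_eq] at t2
    linarith

end FinslerStructure

end
end BanachFinsler

/-! ### Dual norms and transfer of subdifferentials from charts -/

namespace BanachFinsler
noncomputable section

open Filter Set

namespace FinslerStructure

variable {X : Type*} [NormedAddCommGroup X] [NormedSpace ℝ X]
  {M : Type*} [TopologicalSpace M] [ChartedSpace X M] [IsManifold 𝓘(ℝ, X) 1 M]
  (F : FinslerStructure X M)

theorem dualNorm_nonneg (x : M) (Δ : TangentSpace 𝓘(ℝ, X) x →L[ℝ] ℝ) : 0 ≤ F.dualNorm x Δ :=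
  Real.sSup_nonneg (by rintro _ ⟨ξ, -, rfl⟩; exact abs_nonneg _)

theorem dualNorm_neg (x : M) (Δ : TangentSpace 𝓘(ℝ, X) x →L[ℝ] ℝ) :
    F.dualNorm x (-Δ) = F.dualNorm x Δ := by
  unfold dualNorm
  congr 1
  ext r
  refine exists_congr fun ξ => and_congr_right fun _ => ?_
  rw [neg_apply, abs_neg]

theorem dualNorm_le {x : M} {Δ : TangentSpace 𝓘(ℝ, X) x →L[ℝ] ℝ} {C : ℝ} (hC : 0 ≤ C)
    (h : ∀ ξ, |Δ ξ| ≤ C * F.norm ⟨x, ξ⟩) : F.dualNorm x Δ ≤ C :=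
  Real.sSup_le (by rintro _ ⟨ξ, hξ, rfl⟩; simpa [hξ] using h ξ) hC

/-- The bound by `C` only ensures that the set defining the dual norm is bounded above, so that its
supremum is not the default value `0`. -/
theorem le_dualNorm_mul {x : M} {Δ : TangentSpace 𝓘(ℝ, X) x →L[ℝ] ℝ} {C : ℝ}
    (h : ∀ ξ, |Δ ξ| ≤ C * F.norm ⟨x, ξ⟩) (ξ : TangentSpace 𝓘(ℝ, X) x) :
    |Δ ξ| ≤ F.dualNorm x Δ * F.norm ⟨x, ξ⟩ := by
  rcases (F.norm_nonneg ⟨x, ξ⟩).eq_or_lt with h0 | h0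
  · rw [F.eq_zero_of_norm_eq_zero x ξ h0.symm]
    simp [F.norm_zero]
  · set n := F.norm ⟨x, ξ⟩
    have h1 : F.norm ⟨x, n⁻¹ • ξ⟩ = 1 := by
      rw [F.norm_smul, abs_of_pos (inv_pos.2 h0)]
      exact inv_mul_cancel₀ h0.ne'
    have h2 : |Δ (n⁻¹ • ξ)| ≤ F.dualNorm x Δ :=
      le_csSup ⟨C, by rintro _ ⟨ξ, hξ, rfl⟩; simpa [hξ] using h ξ⟩ ⟨_, h1, rfl⟩
    rw [map_smul, smul_eq_mul, abs_mul, abs_of_pos (inv_pos.2 h0), inv_mul_le_iff₀ h0] at h2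
    rwa [mul_comm]

variable {F} {φ : OpenPartialHomeomorph M X}

/-- A `C¹` function on the model space touching `f` from below in a chart provides a
subdifferential of `f`. -/
theorem IsGoodBall.exists_mem_subdifferential [T2Space M] (b : UnitBump X) {y₀ : X} {δ r : ℝ}
    (h : F.IsGoodBall φ y₀ δ r) {y : X} (hy : y ∈ Metric.ball y₀ r) {f : M → ℝ} {G : X → ℝ}
    (hG : ContDiff ℝ 1 G) (hmin : IsLocalMin (fun z => f (φ.symm z) - G z) y) :
    ∃ Δ ∈ subdifferential X f (φ.symm y),
      (∀ v, |fderiv ℝ G y v| ≤ F.dualNorm (φ.symm y) Δ * F.chartNorm φ y v) ∧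
      ∀ C, 0 ≤ C → (∀ v, |fderiv ℝ G y v| ≤ C * F.chartNorm φ y v) →
        F.dualNorm (φ.symm y) Δ ≤ C := by
  have hyt : y ∈ φ.target := h.subset (Metric.ball_subset_closedBall hy)
  set x := φ.symm y with hx
  have hxs : x ∈ φ.source := φ.map_target hyt
  have hφx : φ x = y := φ.right_inv hyt
  obtain ⟨s, hs, hsr⟩ : ∃ s > 0, Metric.closedBall y s ⊆ Metric.closedBall y₀ r := by
    obtain ⟨s, hs, hsr⟩ := Metric.nhds_basis_closedBall.mem_iff.1
      (Metric.isOpen_ball.mem_nhds hy)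
    exact ⟨s, hs, hsr.trans Metric.ball_subset_closedBall⟩
  let k : X → ℝ := fun z => b.toFun (s⁻¹ • (z - y))
  have hk : ContDiff ℝ 1 k := by
    have := b.contDiff
    fun_prop
  have hk1 : ∀ᶠ z in 𝓝 y, k z = 1 := by
    have : Tendsto (fun z => s⁻¹ • (z - y)) (𝓝 y) (𝓝 0) := by
      have hc : Continuous fun z => s⁻¹ • (z - y) := by fun_prop
      simpa using hc.tendsto y
    exact this.eventually b.eventually_one
  have hk0 : ∀ z, k z ≠ 0 → z ∈ Metric.closedBall y s := fun z hz => by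
    by_contra hcon
    rw [mem_closedBall_iff_norm, not_le] at hcon
    refine hz (b.eq_zero _ ?_)
    rw [_root_.norm_smul, norm_inv, Real.norm_of_nonneg hs.le, inv_mul_eq_div]
    exact (one_le_div hs).2 hcon.le
  classical
  -- The test function must be `C¹` on all of `M`, so `G` is cut off inside the chart. Its support
  -- stays in the chart domain because the image of the small closed ball is closed in `M`.
  let g : M → ℝ := fun p => if p ∈ φ.source then k (φ p) * G (φ p) else 0
  have hsupp : tsupport g ⊆ φ.source := by
    have hcl := h.isClosed _ hsr Metric.isClosed_closedBall
    have : Function.support g ⊆ φ.symm '' Metric.closedBall y s := fun p hp => by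
      have hps : p ∈ φ.source := by
        by_contra hcon
        exact hp (if_neg hcon)
      have : k (φ p) * G (φ p) ≠ 0 := by
        rw [Function.mem_support] at hp
        simpa only [g, if_pos hps] using hp
      exact ⟨φ p, hk0 _ (left_ne_zero_of_mul this), φ.left_inv hps⟩
    refine (closure_minimal this hcl).trans ?_
    rintro _ ⟨z, hz, rfl⟩
    exact φ.map_target (h.subset (hsr hz))
  have hgs : ContMDiff 𝓘(ℝ, X) 𝓘(ℝ, ℝ) 1 g := by
    refine contMDiff_of_tsupport fun p hp => ?_
    have hps := hsupp hp
    have h1 : ContMDiffAt 𝓘(ℝ, X) 𝓘(ℝ, X) 1 φ p :=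
      contMDiffAt_of_mem_maximalAtlas h.mem_atlas hps
    have h2 : ContMDiffAt 𝓘(ℝ, X) 𝓘(ℝ, ℝ) 1 (fun z => k z * G z) (φ p) :=
      (hk.mul hG).contMDiff.contMDiffAt
    refine (h2.comp p h1).congr_of_eventuallyEq ?_
    filter_upwards [φ.open_source.mem_nhds hps] with q hq using if_pos hq
  have hgG : g =ᶠ[𝓝 x] fun p => G (φ p) := by
    have h1 : Tendsto φ (𝓝 x) (𝓝 y) := hφx ▸ φ.continuousAt hxs
    filter_upwards [φ.open_source.mem_nhds hxs, h1.eventually hk1] with p hp hp1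
    simp only [g, if_pos hp, hp1, one_mul]
  have hgG' : (g ∘ φ.symm) =ᶠ[𝓝 y] G := by
    have h1 : Tendsto φ.symm (𝓝 y) (𝓝 x) := φ.symm.continuousAt hyt
    filter_upwards [h1.eventually hgG, φ.open_target.mem_nhds hyt] with z hz hzt
    simp only [Function.comp, hz, φ.right_inv hzt]
  have happly : ∀ v : X,
      (tangentMap 𝓘(ℝ, X) 𝓘(ℝ, ℝ) g (tangentMap 𝓘(ℝ, X) 𝓘(ℝ, X) φ.symm ⟨y, v⟩)).2 =
        fderiv ℝ G y v := fun v => by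
    have e := tangentMap_comp_at (I := 𝓘(ℝ, X)) (I' := 𝓘(ℝ, X)) (I'' := 𝓘(ℝ, ℝ))
      (f := φ.symm) (g := g) ⟨y, v⟩ ((hgs x).mdifferentiableAt one_ne_zero)
      (mdifferentiableAt_symm_of_mem_maximalAtlas h.mem_atlas hyt)
    refine (congrArg (fun p : TangentBundle 𝓘(ℝ, ℝ) ℝ => (p.2 : ℝ)) e).symm.trans ?_
    change mfderiv 𝓘(ℝ, X) 𝓘(ℝ, ℝ) (g ∘ φ.symm) y v = fderiv ℝ G y v
    rw [mfderiv_eq_fderiv, hgG'.fderiv_eq]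
    rfl
  -- Every tangent vector at `x` comes from the chart, so bounds on `fderiv ℝ G y` pass to the dual
  -- norm.
  have hlift : ∀ ξ : TangentSpace 𝓘(ℝ, X) x, ∃ v : X,
      tangentMap 𝓘(ℝ, X) 𝓘(ℝ, X) φ.symm ⟨y, v⟩ = ⟨x, ξ⟩ := fun ξ => by
    have e := tangentMap_comp_at (I := 𝓘(ℝ, X)) (I' := 𝓘(ℝ, X)) (I'' := 𝓘(ℝ, X))
      (f := φ) (g := φ.symm) ⟨x, ξ⟩
      (mdifferentiableAt_symm_of_mem_maximalAtlas h.mem_atlas (φ.map_source hxs))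
      (mdifferentiableAt_of_mem_maximalAtlas h.mem_atlas hxs)
    have e2 : tangentMap 𝓘(ℝ, X) 𝓘(ℝ, X) (φ.symm ∘ φ) ⟨x, ξ⟩ = ⟨x, ξ⟩ := by
      have hev : (φ.symm ∘ φ) =ᶠ[𝓝 x] id := φ.eventually_left_inverse hxs
      refine Bundle.TotalSpace.ext (φ.left_inv hxs) (heq_of_eq ?_)
      change mfderiv 𝓘(ℝ, X) 𝓘(ℝ, X) (φ.symm ∘ φ) x ξ = ξ
      rw [hev.mfderiv_eq]
      erw [mfderiv_id]
      rfl
    refine ⟨mfderiv 𝓘(ℝ, X) 𝓘(ℝ, X) φ x ξ, ?_⟩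
    rw [← e2, e]
    congr 1
    exact Bundle.TotalSpace.ext hφx.symm HEq.rfl
  obtain ⟨K, hK, hKv⟩ := F.exists_chartNorm_equiv φ h.mem_atlas hyt
  let Δ : TangentSpace 𝓘(ℝ, X) x →L[ℝ] ℝ := mfderiv 𝓘(ℝ, X) 𝓘(ℝ, ℝ) g x
  have hbound : ∀ C, (∀ v, |fderiv ℝ G y v| ≤ C * F.chartNorm φ y v) →
      ∀ ξ, |Δ ξ| ≤ C * F.norm ⟨x, ξ⟩ := fun C hC ξ => by
    obtain ⟨v, hv⟩ := hlift ξ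
    have h1 := hC v
    rw [← happly v, chartNorm, hv] at h1
    exact h1
  have hcrude : ∀ v, |fderiv ℝ G y v| ≤ ‖fderiv ℝ G y‖ * K * F.chartNorm φ y v := fun v => by
    refine ((fderiv ℝ G y).le_opNorm v).trans ?_
    rw [mul_assoc]
    exact mul_le_mul_of_nonneg_left (hKv v).1 (_root_.norm_nonneg _)
  refine ⟨Δ, ⟨g, hgs, ?_, rfl⟩, fun v => ?_, fun C hC hCv => ?_⟩
  · have h1 : Tendsto φ (𝓝 x) (𝓝 y) := hφx ▸ φ.continuousAt hxs
    filter_upwards [h1.eventually hmin, hgG, φ.open_source.mem_nhds hxs] with p hp hp2 hps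
    have hgx : g x = G y := hφx ▸ hgG.self_of_nhds
    rw [hp2, hgx]
    rwa [φ.left_inv hps] at hp
  · have := F.le_dualNorm_mul (hbound _ hcrude) (mfderiv 𝓘(ℝ, X) 𝓘(ℝ, X) φ.symm y v)
    rw [← happly v]
    exact this
  · exact F.dualNorm_le hC (hbound C hCv)

end FinslerStructure

end
end BanachFinsler

/-! ### Fuzzy sum rule on the manifold -/

namespace BanachFinsler
noncomputable section

open Filter Set

/-- Subdifferentials of a function which is Lipschitz for a seminorm are bounded by the Lipschitz
constant. -/
theorem abs_fderiv_le_of_isLocalMin_sub {X : Type*} [NormedAddCommGroup X] [NormedSpace ℝ X]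
    {p g : X → ℝ} {y : X} (hg : DifferentiableAt ℝ g y)
    (hmin : IsLocalMin (fun z => p z - g z) y) {N : X → ℝ}
    (hN : ∀ (c : ℝ) v, N (c • v) = |c| * N v) {C : ℝ}
    (hp : ∀ᶠ z in 𝓝 y, |p z - p y| ≤ C * N (z - y)) (v : X) : |fderiv ℝ g y v| ≤ C * N v := by
  have key : ∀ v, fderiv ℝ g y v ≤ C * N v := fun v => by
    have hline : HasDerivAt (fun t : ℝ => y + t • v) v 0 := by
      have := ((hasDerivAt_id (0 : ℝ)).smul_const v).const_add y
      rw [one_smul] at this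
      exact this
    have hg' : HasFDerivAt g (fderiv ℝ g y) (y + (0 : ℝ) • v) := by
      simpa using hg.hasFDerivAt
    have hd : HasDerivAt (fun t : ℝ => g (y + t • v)) (fderiv ℝ g y v) 0 :=
      hg'.comp_hasDerivAt (0 : ℝ) hline
    have ht := hd.tendsto_slope_zero_right
    have hto : Tendsto (fun t : ℝ => y + t • v) (𝓝[>] 0) (𝓝 y) := by
      have := hline.continuousAt.tendsto
      rw [zero_smul, add_zero] at this
      exact this.mono_left nhdsWithin_le_nhds
    refine le_of_tendsto ht ?_
    filter_upwards [hto.eventually hmin, hto.eventually hp, self_mem_nhdsWithin] with t h1 h2 h3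
    have h3' : 0 < t := h3
    have h4 := (abs_le.1 h2).2
    rw [add_sub_cancel_left, hN, abs_of_pos h3'] at h4
    simp only [zero_add, zero_smul, add_zero, smul_eq_mul]
    rw [inv_mul_le_iff₀ h3']
    linarith
  refine abs_le.2 ⟨?_, key v⟩
  have h1 := key (-v)
  have h2 : N (-v) = N v := by simpa using hN (-1) v
  rw [map_neg, h2] at h1
  linarith

namespace FinslerStructure

variable {X : Type*} [NormedAddCommGroup X] [NormedSpace ℝ X] [CompleteSpace X]
  {M : Type*} [TopologicalSpace M] [ChartedSpace X M] [IsManifold 𝓘(ℝ, X) 1 M]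
  [T2Space M] [ParacompactSpace M] (F : FinslerStructure X M)

/-- If `f + h` almost has a minimum at `x₀`, and `h` is Lipschitz near `x₀`, there are
subdifferentials of `f` and `h` at close points, with almost equal norms. -/
theorem exists_subdifferential_pair (b : UnitBump X) {f h : M → ℝ} (hf : LowerSemicontinuous f)
    {m : ℝ} (hm : m ≤ 0) (hfm : ∀ x, m ≤ f x) (hhm : ∀ x, m ≤ h x) {x₀ : M} {ε : ℝ} (hε : 0 < ε)
    (hmin : ∀ x, f x₀ + h x₀ ≤ f x + h x + ε * F.dist x x₀) (hL : F.LipschitzNear h x₀) :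
    ∃ x₁ x₂ : M, ∃ Δ₁ ∈ subdifferential X f x₁, ∃ Δ₂ ∈ subdifferential X h x₂,
      F.dist x₁ x₂ ≤ ε ∧ F.dualNorm x₁ Δ₁ * F.dist x₁ x₂ ≤ ε ∧
      F.dualNorm x₂ Δ₂ * F.dist x₁ x₂ ≤ ε ∧
      |F.dualNorm x₁ Δ₁ - F.dualNorm x₂ Δ₂| ≤ 9 * ε ∧ f x₁ + h x₂ ≤ f x₀ + h x₀ + ε := by
  obtain ⟨U, hU, L, hL0, hLU⟩ := hL
  obtain ⟨K, hK, hKv⟩ := F.exists_chartAt_equiv x₀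
  have hK0 : 0 < K := by linarith
  -- `P` bounds both dual norms found below. Taking `δ * P ≤ ε` makes the distortion `(1 + δ) ^ 2`
  -- of these norms cost only a multiple of `ε`.
  set P : ℝ := 4 * L + 6 * ε + 1 with hP
  have hP1 : 1 ≤ P := by linarith
  have hP0 : 0 < P := by linarith
  set δ : ℝ := min 1 (ε / P) with hδ
  have hδ0 : 0 < δ := lt_min one_pos (div_pos hε hP0)
  have hδ1 : δ ≤ 1 := min_le_left _ _
  have hδP : δ * P ≤ ε := (le_div_iff₀ hP0).1 (min_le_right _ _)
  obtain ⟨r, G, hrU⟩ := F.exists_isGoodBall_chartAt x₀ hδ0 hU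
  have hx₀ := mem_chart_source X x₀
  set φ := chartAt X x₀ with hφ
  set y₀ := φ x₀ with hy₀
  have hφy₀ : φ.symm y₀ = x₀ := φ.left_inv hx₀
  set N := F.chartNorm φ y₀ with hN
  have hNsmul : ∀ (c : ℝ) v, N (c • v) = |c| * N v := F.chartNorm_smul φ y₀
  have hN0 : ∀ v, 0 ≤ N v := F.chartNorm_nonneg φ y₀
  have hNz : N 0 = 0 := by simpa using hNsmul 0 0
  have hNtri : ∀ v w, |N v - N w| ≤ N (v - w) := fun v w => by
    have h1 := F.chartNorm_add_le φ y₀ (v - w) w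
    have h2 := F.chartNorm_add_le φ y₀ (w - v) v
    rw [sub_add_cancel] at h1 h2
    rw [F.chartNorm_sub_comm φ y₀ w v] at h2
    exact abs_le.2 ⟨by linarith, by linarith⟩
  have hmemU : ∀ y ∈ Metric.closedBall y₀ r, φ.symm y ∈ U := fun y hy => hrU ⟨y, hy, rfl⟩
  have hdist : ∀ y ∈ Metric.closedBall y₀ r, ∀ z ∈ Metric.closedBall y₀ r,
      F.dist (φ.symm y) (φ.symm z) ≤ 2 * N (y - z) := fun y hy z hz =>
    (G.dist_le hy hz).trans (mul_le_mul_of_nonneg_right (by linarith) (hN0 _))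
  have hhN : ∀ y ∈ Metric.closedBall y₀ r, ∀ z ∈ Metric.closedBall y₀ r,
      |h (φ.symm y) - h (φ.symm z)| ≤ 2 * L * N (y - z) := fun y hy z hz => by
    have := mul_le_mul_of_nonneg_left (hdist y hy z hz) hL0
    linarith [hLU _ (hmemU y hy) _ (hmemU z hz)]
  have hN3 : ∀ y z, |2 * ε * N (y - y₀) - 2 * ε * N (z - y₀)| ≤ 2 * ε * N (y - z) := fun y z => by
    rw [← mul_sub, abs_mul, abs_of_pos (by linarith : 0 < 2 * ε)]
    have := hNtri (y - y₀) (z - y₀)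
    rw [sub_sub_sub_cancel_right] at this
    exact mul_le_mul_of_nonneg_left this (by linarith)
  -- Two points within `ε₁` of `y₀` are at Finsler distance at most `4 * K * ε₁ = ε / P`, so the
  -- product with either dual norm is at most `ε`.
  set ε₁ : ℝ := ε / (4 * K * P) with hε₁
  have hε₁0 : 0 < ε₁ := by positivity
  have hε₁e : 4 * K * ε₁ * P = ε := by rw [hε₁]; field_simp
  have hKε₁ : 4 * K * ε₁ ≤ ε := by
    rw [← hε₁e]
    exact le_mul_of_one_le_right (by positivity) hP1
  have hε₁ε : ε₁ ≤ ε := by nlinarith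
  have hlsc : LowerSemicontinuousOn (f ∘ φ.symm) (Metric.closedBall y₀ r) :=
    lowerSemicontinuous_restrict_iff.1 (hf.comp (φ.continuousOn_symm.mono G.subset).domRestrict)
  obtain ⟨y, z, w, hy, hz, hw, hval, g₁, g₂, g₃, c₁, c₂, c₃, m₁, m₂, m₃, hsum⟩ :=
    b.exists_fuzzy_sum G.pos (f₁ := f ∘ φ.symm) (f₂ := h ∘ φ.symm)
    (f₃ := fun y => 2 * ε * N (y - y₀)) (m := m) hlsc
    -- The common lower bound must also serve the third function, which is nonnegative; hence `m ≤
    -- 0`.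
    (fun y _ => ⟨hfm _, hhm _, hm.trans (mul_nonneg (by linarith) (hN0 _))⟩)
    (L := 2 * (L + ε) * K) (by positivity)
    (fun y hy z hz => by
      refine (hhN y hy z hz).trans ?_
      rw [mul_assoc (2 * (L + ε))]
      exact mul_le_mul (by linarith) (hKv _).2 (hN0 _) (by linarith))
    (fun y hy z hz => by
      refine (hN3 y z).trans ?_
      rw [mul_assoc (2 * (L + ε))]
      exact mul_le_mul (by linarith) (hKv _).2 (hN0 _) (by linarith))
    (fun y hy => by
      have h1 := hmin (φ.symm y)
      have h2 := hdist y hy y₀ G.center_mem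
      rw [hφy₀] at h2
      have h3 := mul_le_mul_of_nonneg_left h2 hε.le
      simp only [Function.comp, hφy₀, sub_self, hNz, mul_zero, add_zero]
      linarith) hε₁0
  have hball : Metric.ball y₀ (min ε₁ r) ⊆ Metric.ball y₀ r :=
    Metric.ball_subset_ball (min_le_right _ _)
  have hyr := Metric.ball_subset_closedBall (hball hy)
  have hzr := Metric.ball_subset_closedBall (hball hz)
  have Λ₂ : ∀ v, |fderiv ℝ g₂ z v| ≤ 2 * L * N v :=
    abs_fderiv_le_of_isLocalMin_sub (c₂.differentiable one_ne_zero z) m₂ hNsmul (by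
      filter_upwards [Metric.isOpen_ball.mem_nhds (hball hz)] with z' hz'
      exact hhN z' (Metric.ball_subset_closedBall hz') z hzr)
  have Λ₃ : ∀ v, |fderiv ℝ g₃ w v| ≤ 2 * ε * N v :=
    abs_fderiv_le_of_isLocalMin_sub (c₃.differentiable one_ne_zero w) m₃ hNsmul
      (Eventually.of_forall fun w' => hN3 w' w)
  -- The norm term contributes `2 * ε * N v` and the fuzzy error at most `ε * N v`.
  have Λ : ∀ v, |fderiv ℝ g₁ y v + fderiv ℝ g₂ z v| ≤ 3 * ε * N v := fun v => by
    have h1 := ContinuousLinearMap.le_of_opNorm_le _ hsum v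
    simp only [add_apply, Real.norm_eq_abs] at h1
    have h2 : ε₁ * ‖v‖ ≤ ε * N v := by
      calc ε₁ * ‖v‖ ≤ ε₁ * (K * N v) := by
            have := (hKv v).1
            gcongr
        _ ≤ ε * N v := by
            rw [← mul_assoc]
            refine mul_le_mul_of_nonneg_right ?_ (hN0 v)
            nlinarith
    have h3 := abs_le.1 (Λ₃ v)
    have h4 := abs_le.1 h1
    exact abs_le.2 ⟨by linarith [h3.2, h4.1], by linarith [h3.1, h4.2]⟩
  obtain ⟨Δ₁, hΔ₁, A₁, B₁⟩ := G.exists_mem_subdifferential b (hball hy) c₁ m₁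
  obtain ⟨Δ₂, hΔ₂, A₂, B₂⟩ := G.exists_mem_subdifferential b (hball hz) c₂ m₂
  set t₁ := F.dualNorm (φ.symm y) Δ₁
  set t₂ := F.dualNorm (φ.symm z) Δ₂
  have ht₁ : 0 ≤ t₁ := F.dualNorm_nonneg _ _
  have ht₂ : 0 ≤ t₂ := F.dualNorm_nonneg _ _
  have lowy := G.lower y hyr
  have lowz := G.lower z hzr
  have upy := G.upper y hyr
  have upz := G.upper z hzr
  have cmp : ∀ {C : ℝ}, 0 ≤ C → ∀ {q a : ℝ}, 0 ≤ a → q ≤ (1 + δ) * a → C * q ≤ 2 * C * a :=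
    fun hC q a ha hq => by
      have := mul_le_mul_of_nonneg_left hq hC
      nlinarith [mul_nonneg hC ha]
  have hNy : ∀ v, 0 ≤ F.chartNorm φ y v := F.chartNorm_nonneg φ y
  have hNz' : ∀ v, 0 ≤ F.chartNorm φ z v := F.chartNorm_nonneg φ z
  have b₂ : t₂ ≤ 2 * (2 * L) := B₂ _ (by positivity) fun v =>
    (Λ₂ v).trans (cmp (by positivity) (hNz' v) (lowz v))
  have b₁ : t₁ ≤ 2 * (2 * L + 3 * ε) := B₁ _ (by positivity) fun v => by
    refine le_trans ?_ (cmp (by positivity) (hNy v) (lowy v))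
    have h1 := abs_le.1 (Λ v)
    have h2 := abs_le.1 (Λ₂ v)
    exact abs_le.2 ⟨by linarith [h1.1, h2.2], by linarith [h1.2, h2.1]⟩
  -- Each passage between a point and the centre costs a factor `1 + δ`; going from `z` to `y` or
  -- back costs two.
  have compare : ∀ {s a c : ℝ}, 0 ≤ s → 0 ≤ a → c ≤ (1 + δ) * a →
      s * ((1 + δ) * c) + 3 * ε * c ≤ ((1 + δ) ^ 2 * s + 3 * ε * (1 + δ)) * a :=
    fun {s a c} hs ha hc => by
      have := mul_le_mul_of_nonneg_left hc
        (show 0 ≤ s * (1 + δ) + 3 * ε by positivity)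
      linarith
  have e₁ : t₁ ≤ (1 + δ) ^ 2 * t₂ + 3 * ε * (1 + δ) := B₁ _ (by positivity) fun v => by
    refine le_trans ?_ (compare ht₂ (hNy v) (lowy v))
    have h1 := abs_le.1 (Λ v)
    have h2 := abs_le.1 ((A₂ v).trans (mul_le_mul_of_nonneg_left (upz v) ht₂))
    exact abs_le.2 ⟨by linarith [h1.1, h2.2], by linarith [h1.2, h2.1]⟩
  have e₂ : t₂ ≤ (1 + δ) ^ 2 * t₁ + 3 * ε * (1 + δ) := B₂ _ (by positivity) fun v => by
    refine le_trans ?_ (compare ht₁ (hNz' v) (lowz v))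
    have h1 := abs_le.1 (Λ v)
    have h2 := abs_le.1 ((A₁ v).trans (mul_le_mul_of_nonneg_left (upy v) ht₁))
    exact abs_le.2 ⟨by linarith [h1.1, h2.2], by linarith [h1.2, h2.1]⟩
  have q₁ : t₁ ≤ P := by linarith
  have q₂ : t₂ ≤ P := by linarith
  -- The nine comes from `2 * δ * s + δ ^ 2 * s ≤ 3 * ε` and `3 * ε * (1 + δ) ≤ 6 * ε`.
  have small : ∀ {s : ℝ}, 0 ≤ s → s ≤ P →
      (1 + δ) ^ 2 * s + 3 * ε * (1 + δ) ≤ s + 9 * ε := fun {s} hs hsP => by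
    have h1 : δ * s ≤ ε := (mul_le_mul_of_nonneg_left hsP hδ0.le).trans hδP
    have h2 : δ * (δ * s) ≤ δ * s := mul_le_of_le_one_left (by positivity) hδ1
    have h3 : ε * δ ≤ ε := mul_le_of_le_one_right hε.le hδ1
    linarith
  have hd : F.dist (φ.symm y) (φ.symm z) ≤ 4 * K * ε₁ := by
    have h1 : ‖y - z‖ ≤ 2 * ε₁ := by
      have hy' := (Metric.mem_ball.1 hy).trans_le (min_le_left _ _)
      have hz' := (Metric.mem_ball.1 hz).trans_le (min_le_left _ _)
      rw [← dist_eq_norm]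
      linarith [dist_triangle_right y z y₀]
    have h2 := (hKv (y - z)).2
    have h3 := mul_le_mul_of_nonneg_left h1 hK0.le
    linarith [hdist y hyr z hzr]
  have hprod : ∀ {s : ℝ}, s ≤ P → s * F.dist (φ.symm y) (φ.symm z) ≤ ε := fun {s} hs => by
    rw [← hε₁e, mul_comm _ P]
    exact mul_le_mul hs hd (F.dist_nonneg _ _) hP0.le
  refine ⟨φ.symm y, φ.symm z, Δ₁, hΔ₁, Δ₂, hΔ₂, hd.trans hKε₁, hprod q₁, hprod q₂,
    abs_le.2 ⟨by linarith [small ht₁ q₁], by linarith [small ht₂ q₂]⟩, ?_⟩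
  simp only [Function.comp, hφy₀, sub_self, hNz, mul_zero, add_zero] at hval
  have := hN0 (w - y₀)
  nlinarith

end FinslerStructure

end
end BanachFinsler

/-! ### Comparison of sub- and supersolutions -/

namespace BanachFinsler
noncomputable section

open Filter Set

variable {X : Type*} [NormedAddCommGroup X] [NormedSpace ℝ X]
  {M : Type*} [TopologicalSpace M] [ChartedSpace X M]

theorem neg_mem_superdifferential {u : M → ℝ} {x : M} {Δ : TangentSpace 𝓘(ℝ, X) x →L[ℝ] ℝ}
    (h : Δ ∈ subdifferential X (fun y => -u y) x) : -Δ ∈ superdifferential X u x := by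
  obtain ⟨g, hg, hmin, rfl⟩ := h
  refine ⟨-g, hg.neg, ?_, mfderiv_neg⟩
  filter_upwards [hmin] with y hy
  simp only [Pi.neg_apply]
  linarith

variable [IsManifold 𝓘(ℝ, X) 1 M]

theorem FinslerStructure.LipschitzNear.neg {F : FinslerStructure X M} {u : M → ℝ} {x : M}
    (h : F.LipschitzNear u x) : F.LipschitzNear (fun y => -u y) x := by
  obtain ⟨U, hU, L, hL, hLU⟩ := h
  refine ⟨U, hU, L, hL, fun y hy z hz => ?_⟩
  rw [neg_sub_neg, abs_sub_comm]
  exact hLU y hy z hz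

variable [CompleteSpace X] [T2Space M] [ParacompactSpace M] [ConnectedSpace M]

/-- Almost maximum points of `u - v` at which the equations for `u` and `v` can be compared. -/
theorem FinslerStructure.exists_comparison (F : FinslerStructure X M) (b : UnitBump X)
    (hF : F.IsComplete) {H₁ H₂ : M × ℝ → ℝ} {u v : M → ℝ}
    (hu : IsViscositySubsolution F H₁ u) (hv : IsViscositySupersolution F H₂ v)
    (hub : ∃ B : ℝ, ∀ x, |u x| ≤ B) (hvb : ∃ B : ℝ, ∀ x, |v x| ≤ B)
    (hLip : ∀ x, F.LipschitzNear u x ∨ F.LipschitzNear v x) {ε : ℝ} (hε : 0 < ε) :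
    ∃ (x₁ x₂ : M) (t₁ t₂ : ℝ), u x₁ + H₁ (x₁, t₁) ≤ 0 ∧ 0 ≤ v x₂ + H₂ (x₂, t₂) ∧
      F.dist x₂ x₁ ≤ ε ∧ |t₁| * F.dist x₂ x₁ ≤ ε ∧ |t₂| * F.dist x₂ x₁ ≤ ε ∧
      |t₂ - t₁| ≤ 9 * ε ∧ ∀ x, u x - v x ≤ u x₁ - v x₂ + 2 * ε := by
  obtain ⟨Bu, hBu⟩ := hub
  obtain ⟨Bv, hBv⟩ := hvb
  obtain ⟨p₀⟩ : Nonempty M := inferInstance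
  have hBu0 : 0 ≤ Bu := (abs_nonneg _).trans (hBu p₀)
  have hBv0 : 0 ≤ Bv := (abs_nonneg _).trans (hBv p₀)
  have hun : LowerSemicontinuous fun x => -u x := fun x =>
    (continuous_neg.continuousAt).comp_upperSemicontinuousAt_antitone (hu.1 x)
      fun _ _ => neg_le_neg
  have hum : ∀ x, -(Bu + Bv) ≤ -u x := fun x => by linarith [(abs_le.1 (hBu x)).2]
  have hvm : ∀ x, -(Bu + Bv) ≤ v x := fun x => by linarith [(abs_le.1 (hBv x)).1]
  obtain ⟨x₀, h1, h2⟩ := F.exists_ekeland hF (hv.1.add hun) (m := -(Bu + Bv))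
    (fun x => by linarith [(abs_le.1 (hBu x)).2, (abs_le.1 (hBv x)).1]) hε
  -- Whichever of `-u` and `v` is Lipschitz near `x₀` plays the role of `h`.
  rcases hLip x₀ with hL | hL
  · obtain ⟨x₂, x₁, Δ₂, hΔ₂, Δ₁, hΔ₁, d, d₂, d₁, hd, hval⟩ :=
      F.exists_subdifferential_pair b hv.1 (by linarith) hvm hum hε h2 hL.neg (h := fun x => -u x)
    refine ⟨x₁, x₂, F.dualNorm x₁ Δ₁, F.dualNorm x₂ Δ₂, ?_, hv.2 x₂ Δ₂ hΔ₂, d, ?_, ?_, hd,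
      fun x => ?_⟩
    · rw [← F.dualNorm_neg]
      exact hu.2 x₁ _ (neg_mem_superdifferential hΔ₁)
    · rwa [abs_of_nonneg (F.dualNorm_nonneg _ _)]
    · rwa [abs_of_nonneg (F.dualNorm_nonneg _ _)]
    · linarith [h1 x]
  · obtain ⟨x₁, x₂, Δ₁, hΔ₁, Δ₂, hΔ₂, d, d₁, d₂, hd, hval⟩ :=
      F.exists_subdifferential_pair b hun (by linarith) hum hvm hε
        (fun x => by linarith [h2 x]) hL
    rw [F.dist_comm] at d d₁ d₂
    refine ⟨x₁, x₂, F.dualNorm x₁ Δ₁, F.dualNorm x₂ Δ₂, ?_, hv.2 x₂ Δ₂ hΔ₂, d, ?_, ?_, ?_,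
      fun x => ?_⟩
    · rw [← F.dualNorm_neg]
      exact hu.2 x₁ _ (neg_mem_superdifferential hΔ₁)
    · rwa [abs_of_nonneg (F.dualNorm_nonneg _ _)]
    · rwa [abs_of_nonneg (F.dualNorm_nonneg _ _)]
    · rwa [abs_sub_comm]
    · linarith [h1 x]

/-- Up to `2 * ε`, `u x - v x` is at most `H₂ (x₂, t₂) - H₁ (x₁, t₁)`. Condition (A) for `H₁` moves
the second term to `(x₂, t₂)`, where the difference is at most `S`. -/
theorem sub_le_of_forall_hamiltonian_sub_le (hX : HasC1LipschitzBump X)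
    (F : FinslerStructure X M) (hF : F.IsComplete) {H₁ H₂ : M × ℝ → ℝ}
    (hA₁ : ConditionA F H₁) {u v : M → ℝ}
    (hu : IsViscositySubsolution F H₁ u) (hv : IsViscositySupersolution F H₂ v)
    (hub : ∃ B : ℝ, ∀ x, |u x| ≤ B) (hvb : ∃ B : ℝ, ∀ x, |v x| ≤ B)
    (hLip : ∀ x, F.LipschitzNear u x ∨ F.LipschitzNear v x) {S : ℝ}
    (hS : ∀ p, H₂ p - H₁ p ≤ S) (x : M) : u x - v x ≤ S := by
  obtain ⟨b⟩ := hX.nonempty_unitBump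
  obtain ⟨C, hC, ω, hω, hω0, hA⟩ := hA₁
  refine le_of_forall_pos_le_add fun η hη => ?_
  obtain ⟨r, hr, hrω⟩ := Metric.continuousAt_iff.1 (hω.continuousAt (x := (0, 0))) (η / 2) (half_pos hη)
  -- The first bound gives `9 * ε < r`, so the modulus contributes at most `η / 2`; the second gives
  -- `(C + 2) * ε ≤ η / 2` for the product term and the defect `2 * ε`.
  set ε : ℝ := min (r / 18) (η / (2 * (C + 2))) with hεdef
  have hε : 0 < ε := by positivity
  have hεr : ε ≤ r / 18 := min_le_left _ _
  have hεη : ε * (2 * (C + 2)) ≤ η := (le_div_iff₀ (by positivity)).1 (min_le_right _ _)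
  obtain ⟨x₁, x₂, t₁, t₂, hu₁, hv₂, hd, hd₁, hd₂, ht, hx⟩ :=
    F.exists_comparison b hF hu hv hub hvb hLip hε
  have h1 := (abs_le.1 (hA x₂ x₁ t₂ t₁)).2
  have h2 : ω (F.dist x₂ x₁, t₂ - t₁) ≤ η / 2 := by
    have := @hrω (F.dist x₂ x₁, t₂ - t₁) (by
      rw [Prod.dist_eq, max_lt_iff, Real.dist_0_eq_abs, Real.dist_0_eq_abs,
        abs_of_nonneg (F.dist_nonneg _ _)]
      constructor <;> linarith)
    rw [hω0, Real.dist_0_eq_abs] at this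
    exact (le_abs_self _).trans this.le
  have h3 : C * max |t₂| |t₁| * F.dist x₂ x₁ ≤ C * ε := by
    rw [mul_assoc]
    refine mul_le_mul_of_nonneg_left ?_ hC
    rcases max_choice |t₂| |t₁| with h | h <;> rw [h] <;> assumption
  linarith [hS (x₂, t₂), hx x]

end
end BanachFinsler

theorem mainTheorem10
    {X : Type*} [NormedAddCommGroup X] [NormedSpace ℝ X] [CompleteSpace X]
    (hX : BanachFinsler.HasC1LipschitzBump X)
    {M : Type*} [TopologicalSpace M] [T2Space M] [ParacompactSpace M] [ConnectedSpace M]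
    [ChartedSpace X M] [IsManifold 𝓘(ℝ, X) 1 M]
    (F : BanachFinsler.FinslerStructure X M) (hF : F.IsComplete)
    (H₁ H₂ : M × ℝ → ℝ) (hH₁ : Continuous H₁) (hH₂ : Continuous H₂)
    (hA₁ : BanachFinsler.ConditionA F H₁) (hA₂ : BanachFinsler.ConditionA F H₂)
    (u v : M → ℝ)
    (hu : BanachFinsler.IsViscositySubsolution F H₁ u)
    (hv : BanachFinsler.IsViscositySupersolution F H₂ v)
    (hub : ∃ B : ℝ, ∀ x, |u x| ≤ B) (hvb : ∃ B : ℝ, ∀ x, |v x| ≤ B)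
    (hLip : ∀ x, F.LipschitzNear u x ∨ F.LipschitzNear v x) :
    (⨆ x : M, ((u x - v x : ℝ) : EReal)) ≤
      ⨆ p : M × ℝ, ((H₂ p - H₁ p : ℝ) : EReal) := by
  refine iSup_le fun x => ?_
  have hle := le_iSup fun p : M × ℝ => ((H₂ p - H₁ p : ℝ) : EReal)
  -- Only the upper-bound property of the supremum is needed. It cannot be `⊥`, since it dominates a
  -- real value at `(x, 0)`.
  generalize (⨆ p : M × ℝ, ((H₂ p - H₁ p : ℝ) : EReal)) = S at hle
  induction S using EReal.rec with
  | bot => exact absurd (le_bot_iff.1 (hle (x, 0))) (EReal.coe_ne_bot _)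
  | top => exact le_top
  | coe S =>
    exact EReal.coe_le_coe_iff.2 (BanachFinsler.sub_le_of_forall_hamiltonian_sub_le hX F hF hA₁
      hu hv hub hvb hLip (fun p => EReal.coe_le_coe_iff.1 (hle p)) x)
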